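/- **Fractional Helmholtz equation with source $\delta(x)\,y^{-\beta}/\Gamma(1-\beta)$.** Let $1<\alpha\le 2$, $|\theta|\le\min\{\alpha,2-\alpha\}$, $1<\mu\le 2$, $0\le\nu\le 1$, $k\in\mathbb R$ and $\beta<1-\nu(2-\mu)$. Put $\psi_\alpha^\theta(\kappa)=|\kappa|^\alpha e^{i\,\mathrm{sign}(\kappa)\theta\pi/2}$ and $E_{a,b}(z)=\sum_{n\ge0}z^n/\Gamma(an+b)$. The Fourier transform is $\hat\varphi(\kappa)=\int\varphi(x)e^{i\kappa x}dx$. *Generalized functions of $x$* are linear functionals on the space $Z$ of Schwartz functions $\varphi$ for which $\hat\varphi$ has compact support. A locally integrable $h$ is the Fourier transform of $T$ if $T(\varphi)=\frac1{2\pi}\int h(\kappa)\hat\varphi(-\kappa)\,d\kappa$ for all $\varphi\in Z$; we then write $\hat T=h$ and $T=\frac1{2\pi}\int h(\kappa)e^{-i\kappa x}d\kappa$. The Riesz–Feller derivative ${}_xD^\alpha_\theta$ and the quantum Riesz–Feller derivative ${}_xD^{*,\alpha}_\theta$ multiply the Fourier transform by $-\psi_\alpha^\theta$ and by $\psi_\alpha^\theta$,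 respectively. Let $I^\gamma$ be the Riemann–Liouville integral in $y$ with base point $0$ ($I^0$ is the identity), and let ${}_yD^{\mu,\nu}_{0+}=I^{\nu(2-\mu)}\frac{d^2}{dy^2}I^{(1-\nu)(2-\mu)}$ be the Hilfer derivative. For families $N(\cdot,y)$ of generalized functions these act on the scalar functions $y\mapsto\langle N(\cdot,y),\varphi\rangle$, $\varphi\in Z$. Let $f,g$ be generalized functions with locally integrable Fourier transforms $\hat f,\hat g$ (for example integrable functions, or $\delta$). Consider, for $x\in\mathbb R$ and $y>0$, the equation $${}_xD^\alpha_\theta N(x,y)+{}_yD^{\mu,\nu}_{0+}N(x,y)+k^2N(x,y)=\delta(x)\frac{y^{-\beta}}{\Gamma(1-\beta)},$$ or the same equation with ${}_xD^{*,\alpha}_\theta$ in place of ${}_xD^\alpha_\theta$, with the boundary conditions $$\big(I^{(1-\nu)(2-\mu)}N\big)(x,0+)=f(x),\qquad \Big(\tfrac{d}{dy}I^{(1-\nu)(2-\mu)}N\Big)(x,0+)=g(x),\qquad \lim_{x\to\pm\infty}N(x,y)=0.$$ A *solution* is a family $N(\cdot,y)$, $y>0$, of generalized functions of $x$ such that $\hat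 N(\kappa,y)$ is a function integrable over $[-R,R]\times(0,Y]$ for all $R,Y>0$; the derivatives exist, and the integrals converge absolutely, in the Hilfer derivative of each $\langle N(\cdot,y),\varphi\rangle$ at each $y>0$; and the equation and boundary conditions hold when tested against every $\varphi\in Z$, the last one as $\langle N(\cdot+h,y),\varphi\rangle\to0$ for $h\to\pm\infty$. Then a solution exists, it is unique, and it is given for $y>0$ by $$\begin{aligned}N(x,y)={}&\frac{y^{-(1-\nu)(2-\mu)}}{2\pi}\int_{-\infty}^\infty E_{\mu,1-(1-\nu)(2-\mu)}\big(y^\mu(\pm\psi_\alpha^\theta(\kappa)-k^2)\big)\hat f(\kappa)e^{-i\kappa x}d\kappa\\&+\frac{y^{1-(1-\nu)(2-\mu)}}{2\pi}\int_{-\infty}^\infty E_{\mu,2-(1-\nu)(2-\mu)}\big(y^\mu(\pm\psi_\alpha^\theta(\kappa)-k^2)\big)\hat g(\kappa)e^{-i\kappa x}d\kappa\\&+\frac{y^{\mu-\beta}}{2\pi}\int_{-\infty}^\infty E_{\mu,\mu-\beta+1}\big(y^\mu(\pm\psi_\alpha^\theta(\kappa)-k^2)\big)e^{-i\kappa x}d\kappa,\end{aligned}$$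 with the upper signs for the Riesz–Feller derivative and the lower signs for the quantum one. Here the integrals are Fourier integrals of locally integrable functions of $\kappa$ in the above sense. For each $y>0$ at which the three integrands are absolutely integrable over $\kappa\in\mathbb R$, they are ordinary integrals: $N(\cdot,y)$ is then the function of $x$ displayed, and it tends to $0$ as $x\to\pm\infty$. -/

import Mathlib

open MeasureTheory Filter Topology
open scoped SchwartzMap

namespace FracHelmholtz

noncomputable section

/-! ### The Fourier transform `∫ φ(x) exp(iκx) dx` and the test functions -/

/-- The Fourier transform, with the convention `φ̂(κ) = ∫ φ(x) exp(iκx) dx`. -/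
def fourierHat (φ : ℝ → ℂ) (κ : ℝ) : ℂ :=
  ∫ x : ℝ, φ x * Complex.exp (Complex.I * κ * x)

theorem integrable_mul_exp (φ : 𝓢(ℝ, ℂ)) (κ : ℝ) :
    Integrable (fun x : ℝ => φ x * Complex.exp (Complex.I * κ * x)) := by
  refine φ.integrable.mul_bdd (c := 1) (by fun_prop) (Eventually.of_forall fun x => ?_)
  rw [show Complex.I * κ * x = ((κ * x : ℝ) : ℂ) * Complex.I by push_cast; ring,
    Complex.norm_exp_ofReal_mul_I]

/-- The test functions: Schwartz functions whose Fourier transform has compact support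
(as `φ` runs through them, `φ̂` runs through all smooth functions with compact support). -/
def TestSpace : Submodule ℂ 𝓢(ℝ, ℂ) where
  carrier := {φ | HasCompactSupport (fourierHat φ)}
  zero_mem' := by
    have h : fourierHat ((0 : 𝓢(ℝ, ℂ)) : ℝ → ℂ) = 0 := by
      funext κ
      simp [fourierHat]
    change HasCompactSupport (fourierHat ((0 : 𝓢(ℝ, ℂ)) : ℝ → ℂ))
    rw [h]
    exact HasCompactSupport.zero
  add_mem' := by
    intro φ χ hφ hχ
    have h : fourierHat ((φ + χ : 𝓢(ℝ, ℂ)) : ℝ → ℂ) = fourierHat φ + fourierHat χ := by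
      funext κ
      simp only [fourierHat, Pi.add_apply, add_mul, add_apply]
      exact integral_add (integrable_mul_exp φ κ) (integrable_mul_exp χ κ)
    change HasCompactSupport (fourierHat ((φ + χ : 𝓢(ℝ, ℂ)) : ℝ → ℂ))
    rw [h]
    exact HasCompactSupport.add hφ hχ
  smul_mem' := by
    intro c φ hφ
    have h : fourierHat ((c • φ : 𝓢(ℝ, ℂ)) : ℝ → ℂ) = fun κ => c * fourierHat φ κ := by
      funext κ
      simp only [fourierHat, smul_apply, smul_eq_mul, mul_assoc]
      exact integral_const_mul c _
    change HasCompactSupport (fourierHat ((c • φ : 𝓢(ℝ, ℂ)) : ℝ → ℂ))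
    rw [h]
    exact HasCompactSupport.mul_left hφ

/-- The translate `x ↦ φ(x - h)` of a test function. -/
def translate (h : ℝ) (φ : TestSpace) : TestSpace :=
  ⟨SchwartzMap.compSubConstCLM ℂ h (φ : 𝓢(ℝ, ℂ)), by
    have key : fourierHat (SchwartzMap.compSubConstCLM ℂ h (φ : 𝓢(ℝ, ℂ)) : ℝ → ℂ)
        = fun κ : ℝ => Complex.exp (Complex.I * κ * h) * fourierHat (φ : 𝓢(ℝ, ℂ)) κ := by
      funext κ
      have e := integral_sub_right_eq_self (μ := volume)
        (fun x : ℝ => (φ : 𝓢(ℝ, ℂ)) x * Complex.exp (Complex.I * κ * ((x + h : ℝ) : ℂ))) h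
      simp only [fourierHat, SchwartzMap.compSubConstCLM_apply]
      simp only [sub_add_cancel] at e
      rw [e, ← integral_const_mul]
      congr 1
      funext x
      rw [show Complex.I * κ * ((x + h : ℝ) : ℂ)
        = Complex.I * κ * h + Complex.I * κ * x by push_cast; ring, Complex.exp_add]
      ring
    change HasCompactSupport (fourierHat (SchwartzMap.compSubConstCLM ℂ h (φ : 𝓢(ℝ, ℂ)) : ℝ → ℂ))
    rw [key]
    exact HasCompactSupport.mul_left φ.2⟩

/-! ### Generalized functions of `x` and their Fourier transforms -/

/-- Generalized functions of `x`: linear functionals on the test functions. Those with a locally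
integrable Fourier transform in the sense of `HasFourier` are automatically continuous. -/
abbrev GenFun : Type := TestSpace →ₗ[ℂ] ℂ

/-- The Dirac delta `δ(x)`. -/
def dirac : GenFun where
  toFun φ := (φ : 𝓢(ℝ, ℂ)) 0
  map_add' _ _ := rfl
  map_smul' _ _ := rfl

/-- The Fourier integral `(2π)⁻¹ ∫ h(κ) exp(-iκx) dκ` of a locally integrable `h`, as a generalized
function of `x`: against a test function `φ` it is
`(2π)⁻¹ ∫ h(κ) (∫ exp(-iκx) φ(x) dx) dκ = (2π)⁻¹ ∫ h(κ) φ̂(-κ) dκ`. -/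
def fourierIntegral (h : ℝ → ℂ) (φ : TestSpace) : ℂ :=
  (2 * Real.pi : ℂ)⁻¹ * ∫ κ : ℝ, h κ * fourierHat (φ : 𝓢(ℝ, ℂ)) (-κ)

/-- The locally integrable function `h` is the Fourier transform of `T`. -/
def HasFourier (T : GenFun) (h : ℝ → ℂ) : Prop :=
  LocallyIntegrable h ∧ ∀ φ : TestSpace, T φ = fourierIntegral h φ

/-! ### The Riesz–Feller derivatives -/

/-- `ψ(κ) = |κ|^α exp(i sign(κ) θπ/2)`. -/
def psi (α θ κ : ℝ) : ℂ :=
  ((|κ| ^ α : ℝ) : ℂ) * Complex.exp (Complex.I * (Real.sign κ * (θ * Real.pi / 2) : ℝ))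

/-- `S` is the Riesz–Feller derivative of `T` of order `α` and skewness `θ`: `Ŝ = -ψ T̂`. -/
def IsRieszFeller (α θ : ℝ) (T S : GenFun) : Prop :=
  ∃ h : ℝ → ℂ, HasFourier T h ∧ HasFourier S (fun κ => -psi α θ κ * h κ)

/-- `S` is the quantum Riesz–Feller derivative of `T`: `Ŝ = ψ T̂`. -/
def IsQuantumRieszFeller (α θ : ℝ) (T S : GenFun) : Prop :=
  ∃ h : ℝ → ℂ, HasFourier T h ∧ HasFourier S (fun κ => psi α θ κ * h κ)

/-! ### Fractional calculus in `y` -/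

/-- The Riemann–Liouville integral of order `γ ≥ 0` with base point `0`. -/
def rlInt (γ : ℝ) (u : ℝ → ℂ) (y : ℝ) : ℂ :=
  if γ = 0 then u y
  else ((Real.Gamma γ)⁻¹ : ℝ) * ∫ t in (0 : ℝ)..y, (((y - t) ^ (γ - 1) : ℝ) : ℂ) * u t

/-- The integral defining `rlInt γ u y` converges absolutely. -/
def RLConverges (γ : ℝ) (u : ℝ → ℂ) (y : ℝ) : Prop :=
  γ = 0 ∨ IntervalIntegrable (fun t => (((y - t) ^ (γ - 1) : ℝ) : ℂ) * u t) volume 0 y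

/-- The Hilfer derivative of order `μ`, `n - 1 < μ ≤ n`, and type `ν`:
`I^{ν(n-μ)} (d/dy)^n I^{(1-ν)(n-μ)} u`. -/
def hilferDeriv (n : ℕ) (μ ν : ℝ) (u : ℝ → ℂ) : ℝ → ℂ :=
  rlInt (ν * (n - μ)) (iteratedDeriv n (rlInt ((1 - ν) * (n - μ)) u))

/-- All operations in `hilferDeriv n μ ν u` are meaningful at every `y > 0`. -/
def HilferDifferentiable (n : ℕ) (μ ν : ℝ) (u : ℝ → ℂ) : Prop :=
  (∀ y, 0 < y → RLConverges ((1 - ν) * (n - μ)) u y) ∧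
  (∀ j < n, ∀ y, 0 < y →
    DifferentiableAt ℝ (iteratedDeriv j (rlInt ((1 - ν) * (n - μ)) u)) y) ∧
  (∀ y, 0 < y →
    RLConverges (ν * (n - μ)) (iteratedDeriv n (rlInt ((1 - ν) * (n - μ)) u)) y)

/-- The two-parameter Mittag-Leffler function `∑ zⁿ / Γ(an + b)`. -/
def mittagLeffler (a b : ℝ) (z : ℂ) : ℂ :=
  ∑' n : ℕ, z ^ n / (Real.Gamma (a * n + b) : ℂ)

/-! ### The boundary value problem -/

/-- `N`, where `N y` stands for `N(·, y)`, solves on `y > 0` the problem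
`D_x N + D_y^{μ,ν} N + k² N = Φ`, `(I^{(1-ν)(2-μ)} N)(x,0+) = f(x)`,
`(d/dy I^{(1-ν)(2-μ)} N)(x,0+) = g(x)`, `N(x,y) → 0` as `x → ±∞`, in the sense of generalized
functions of `x`. Here `D T S` says that `S` is the `x`-derivative in question of `T`. -/
structure IsSolution (D : GenFun → GenFun → Prop) (μ ν k : ℝ) (f g : GenFun)
    (Φ : ℝ → GenFun) (N : ℝ → GenFun) : Prop where
  /-- The Fourier transform in `x` is a function of `(κ, y)`, locally integrable up to `y = 0`. -/
  fourier_integrable : ∃ Nh : ℝ → ℝ → ℂ,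
    (∀ y, 0 < y → HasFourier (N y) (fun κ => Nh κ y)) ∧
    ∀ R Y : ℝ, IntegrableOn (fun p : ℝ × ℝ => Nh p.1 p.2) (Set.Icc (-R) R ×ˢ Set.Ioc 0 Y)
  differentiable : ∀ φ : TestSpace, HilferDifferentiable 2 μ ν (fun y => N y φ)
  equation : ∀ y, 0 < y → ∃ S : GenFun, D (N y) S ∧
    ∀ φ : TestSpace,
      S φ + hilferDeriv 2 μ ν (fun y' => N y' φ) y + (k : ℂ) ^ 2 * N y φ = Φ y φ
  boundary_f : ∀ φ : TestSpace,
    Tendsto (rlInt ((1 - ν) * (2 - μ)) (fun y => N y φ)) (𝓝[>] 0) (𝓝 (f φ))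
  boundary_g : ∀ φ : TestSpace,
    Tendsto (deriv (rlInt ((1 - ν) * (2 - μ)) (fun y => N y φ))) (𝓝[>] 0) (𝓝 (g φ))
  /-- `N(x, y) → 0` as `x → ±∞`: the translates `N(· + h, y)` tend weakly to `0` as `h → ±∞`. -/
  decay : ∀ y, 0 < y → ∀ φ : TestSpace,
    Tendsto (fun h => N y (translate h φ)) (cocompact ℝ) (𝓝 0)

end

end FracHelmholtz

namespace FracHelmholtz

noncomputable section

/-! ### Beta integrals -/

/-! In Fourier variables the problem reads `D_y^{μ,ν} N̂ = L N̂ + y^{-β}/Γ(1-β)` with `L = ±ψ - k²`.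
It holds only after testing against `φ`, but `φ̂` has compact support and `L` is continuous, so `L`
is bounded where it matters.

Existence. Tested against `φ`, each of the three terms of the formula becomes a series `∑ cₙ
y^{μn+b-1}/Γ(μn+b)`, where `cₙ` is the pairing of `Lⁿ h` with `φ` (`fourierIntegral_mlKernel`). The
`cₙ` grow at most geometrically, so the series may be treated term by term: `I^γ` replaces `b` by
`b+γ` (`rlInt_powerSeries`) and `d/dy` replaces `b` by `b-1` (`hasDerivAt_powerSeries`). The Hilfer
derivative therefore replaces `b` by `b-μ`, which is a shift of the coefficients, that is,
multiplication by `L`, plus a leading term. That term is annihilated for the `f` and `g` blocks,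
where it carries the initial value, and is the source for the third block (`hasHilfer_solutionHat`).
Decay in `x` is the Riemann–Lebesgue lemma.

Uniqueness. Integrating the equation turns a solution into `I^{1+γ₀} N = f y + g y²/2 + I^{1+γ₀+μ}(L
N + Φ)`, where `γ₀ = (1-ν)(2-μ)` (`rlInt_eq_of_hilfer`). One integration more than needed makes all
orders at least 1, so kernels are bounded and Fubini applies to a merely integrable `N̂(κ,y)`. The
difference `W` of two solutions satisfies `I^a W = L I^{a+μ} W`. Iterating gives `I^a W = Lⁿ
I^{a+nμ} W`, and `1/Γ(nμ+a)` beats the growth of `Lⁿ` (`IsLocIntegrableFamily.rlInt_eq_zero`).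
Differentiating back, the functions `I^{γ₀} N` agree, hence so do the Hilfer derivatives at every
`y`. The equation then gives `L N̂₁ = L N̂₂`, and `L` vanishes at no more than two points, so the
solutions agree at every `y` and not just at almost every one (`IsSolution.unique`). -/

theorem integral_rpow_mul_rpow {a b : ℝ} (ha : 0 < a) (hb : 0 < b) {y : ℝ} (hy : 0 < y) :
    ∫ t in (0 : ℝ)..y, (y - t) ^ (a - 1) * t ^ (b - 1) =
      y ^ (a + b - 1) * (Real.Gamma a * Real.Gamma b / Real.Gamma (a + b)) := by
  have h := Complex.betaIntegral_scaled (b : ℂ) (a : ℂ) hy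
  have h2 : ∫ x in (0 : ℝ)..y, (x : ℂ) ^ ((b : ℂ) - 1) * ((y : ℂ) - x) ^ ((a : ℂ) - 1) =
      ∫ x in (0 : ℝ)..y, (((y - x) ^ (a - 1) * x ^ (b - 1) : ℝ) : ℂ) := by
    refine intervalIntegral.integral_congr fun x hx => ?_
    rw [Set.uIcc_of_le hy.le] at hx
    have h1 : 0 ≤ y - x := by linarith [hx.2]
    simp only [Complex.ofReal_mul]
    rw [Complex.ofReal_cpow h1, Complex.ofReal_cpow hx.1]
    push_cast
    ring
  rw [h2, intervalIntegral.integral_ofReal,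
    Complex.betaIntegral_eq_Gamma_mul_div _ _ (by simpa using hb) (by simpa using ha)] at h
  rw [← Complex.ofReal_add, Complex.Gamma_ofReal, Complex.Gamma_ofReal, Complex.Gamma_ofReal,
    show ((b + a : ℝ) : ℂ) - 1 = ((b + a - 1 : ℝ) : ℂ) by push_cast; ring,
    ← Complex.ofReal_cpow hy.le] at h
  have h3 : ∫ t in (0 : ℝ)..y, (y - t) ^ (a - 1) * t ^ (b - 1) =
      y ^ (b + a - 1) * (Real.Gamma b * Real.Gamma a / Real.Gamma (b + a)) := by
    exact_mod_cast h
  rw [h3, add_comm b a, mul_comm (Real.Gamma b)]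

theorem intervalIntegrable_rpow_mul_rpow {a b : ℝ} (ha : 0 < a) (hb : 0 < b) {y : ℝ}
    (hy : 0 < y) :
    IntervalIntegrable (fun t => (y - t) ^ (a - 1) * t ^ (b - 1)) volume 0 y := by
  refine intervalIntegral.intervalIntegrable_of_integral_ne_zero ?_
  rw [integral_rpow_mul_rpow ha hb hy]
  have := Real.Gamma_pos_of_pos ha
  have := Real.Gamma_pos_of_pos hb
  have := Real.Gamma_pos_of_pos (add_pos ha hb)
  -- A function that is not integrable would have integral 0, so positivity of the Beta value
  -- already proves integrability.
  positivity

theorem integral_rpow_mul_rpow_sub {a b : ℝ} (ha : 0 < a) (hb : 0 < b) {s y : ℝ} (hy : s < y) :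
    ∫ t in s..y, (y - t) ^ (a - 1) * (t - s) ^ (b - 1) =
      (y - s) ^ (a + b - 1) * (Real.Gamma a * Real.Gamma b / Real.Gamma (a + b)) := by
  rw [← integral_rpow_mul_rpow ha hb (sub_pos.2 hy)]
  have := intervalIntegral.integral_comp_sub_right (a := s) (b := y)
    (fun t => (y - s - t) ^ (a - 1) * t ^ (b - 1)) s
  rw [sub_self] at this
  rw [← this]
  refine intervalIntegral.integral_congr fun t _ => ?_
  simp only [sub_sub_sub_cancel_right]

theorem intervalIntegrable_rpow_mul_rpow_sub {a b : ℝ} (ha : 0 < a) (hb : 0 < b) {s y : ℝ}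
    (hy : s < y) :
    IntervalIntegrable (fun t => (y - t) ^ (a - 1) * (t - s) ^ (b - 1)) volume s y := by
  refine intervalIntegral.intervalIntegrable_of_integral_ne_zero ?_
  rw [integral_rpow_mul_rpow_sub ha hb hy]
  have := Real.Gamma_pos_of_pos ha
  have := Real.Gamma_pos_of_pos hb
  have := Real.Gamma_pos_of_pos (add_pos ha hb)
  have := sub_pos.2 hy
  positivity

/-! ### Series of Mittag-Leffler type -/

/-- Comparison with the exponential series. As `b` may be negative, finitely many terms are dropped
so that the argument of `Γ` is at least `n + 2`, in the range `[2, ∞)` where `Γ` increases. -/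
theorem summable_pow_div_abs_Gamma {a : ℝ} (ha : 1 ≤ a) (b M : ℝ) (hM : 0 ≤ M) :
    Summable (fun n : ℕ => M ^ n / |Real.Gamma (a * n + b)|) := by
  obtain ⟨m, hm⟩ := exists_nat_gt (-b)
  rw [← summable_nat_add_iff (m + 2)]
  have h := ((Real.summable_pow_div_factorial M).mul_left (M ^ (m + 2)))
  refine Summable.of_nonneg_of_le (fun n => by positivity) (fun n => ?_) h
  have h1 : ((n : ℝ) + 1) + 1 ≤ a * ((n + (m + 2) : ℕ) : ℝ) + b := by
    push_cast
    have : (0 : ℝ) ≤ n := n.cast_nonneg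
    have : (0 : ℝ) ≤ m := m.cast_nonneg
    nlinarith
  have h2 : (n.factorial : ℝ) ≤ Real.Gamma (a * ((n + (m + 2) : ℕ) : ℝ) + b) := by
    calc (n.factorial : ℝ) ≤ ((n + 1).factorial : ℝ) := by
          exact_mod_cast Nat.factorial_le (Nat.le_succ n)
      _ = Real.Gamma (((n : ℝ) + 1) + 1) := by
          have := Real.Gamma_nat_eq_factorial (n + 1)
          rw [← this]
          push_cast
          rfl
      _ ≤ _ := by
          have : (0 : ℝ) ≤ n := n.cast_nonneg
          exact Real.Gamma_strictMonoOn_Ici.monotoneOn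
            (Set.mem_Ici.2 (by linarith)) (Set.mem_Ici.2 (by linarith)) h1
  have h3 : (0 : ℝ) < n.factorial := by positivity
  calc M ^ (n + (m + 2)) / |Real.Gamma (a * ((n + (m + 2) : ℕ) : ℝ) + b)|
      ≤ M ^ (n + (m + 2)) / n.factorial := by
        rw [abs_of_pos (h3.trans_le h2)]
        gcongr
    _ = _ := by rw [pow_add]; ring

/-- The coefficients `c` grow at most geometrically. -/
def GeomBounded (c : ℕ → ℂ) : Prop := ∃ C M : ℝ, 0 ≤ C ∧ 0 ≤ M ∧ ∀ n, ‖c n‖ ≤ C * M ^ n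

theorem GeomBounded.shift {c : ℕ → ℂ} (h : GeomBounded c) : GeomBounded fun n => c (n + 1) := by
  obtain ⟨C, M, hC, hM, h⟩ := h
  exact ⟨C * M, M, by positivity, hM, fun n => (h (n + 1)).trans_eq (by ring)⟩

/-- The series `∑ cₙ y^{μn+b-1} / Γ(μn+b)`. -/
def powerSeries (μ b : ℝ) (c : ℕ → ℂ) (y : ℝ) : ℂ :=
  ∑' n : ℕ, c n * ((y ^ (μ * n + b - 1) / Real.Gamma (μ * n + b) : ℝ) : ℂ)

theorem rpow_mul_nat_add {μ b y : ℝ} (hy : 0 < y) (n : ℕ) :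
    y ^ (μ * n + b - 1) = y ^ (b - 1) * (y ^ μ) ^ n := by
  rw [show μ * n + b - 1 = (b - 1) + μ * n by ring, Real.rpow_add hy, Real.rpow_mul hy.le,
    Real.rpow_natCast]

theorem norm_powerSeries_term_le {μ b C M : ℝ} {c : ℕ → ℂ} (hC : 0 ≤ C) (hM : 0 ≤ M)
    (hc : ∀ n, ‖c n‖ ≤ C * M ^ n) {y : ℝ} (hy : 0 < y) {K Y : ℝ} (hK : y ^ (b - 1) ≤ K)
    (hY : y ^ μ ≤ Y) (n : ℕ) :
    ‖c n * ((y ^ (μ * n + b - 1) / Real.Gamma (μ * n + b) : ℝ) : ℂ)‖ ≤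
      C * K * ((M * Y) ^ n / |Real.Gamma (μ * n + b)|) := by
  have hy1 : 0 < y ^ (b - 1) := Real.rpow_pos_of_pos hy _
  have hy2 : 0 < y ^ μ := Real.rpow_pos_of_pos hy _
  rw [norm_mul, Complex.norm_real, Real.norm_eq_abs, abs_div,
    abs_of_nonneg (Real.rpow_nonneg hy.le _), rpow_mul_nat_add hy]
  calc ‖c n‖ * (y ^ (b - 1) * (y ^ μ) ^ n / |Real.Gamma (μ * n + b)|)
      ≤ C * M ^ n * (K * Y ^ n / |Real.Gamma (μ * n + b)|) := by
        have hK0 : 0 ≤ K := hy1.le.trans hK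
        gcongr
        exact hc n
    _ = _ := by rw [mul_pow]; ring

theorem summable_powerSeries {μ b : ℝ} (hμ : 1 ≤ μ) {c : ℕ → ℂ} (hc : GeomBounded c) {y : ℝ}
    (hy : 0 < y) :
    Summable fun n : ℕ => c n * ((y ^ (μ * n + b - 1) / Real.Gamma (μ * n + b) : ℝ) : ℂ) := by
  obtain ⟨C, M, hC, hM, hc⟩ := hc
  exact Summable.of_norm_bounded
    ((summable_pow_div_abs_Gamma hμ b _ (by positivity)).mul_left _)
    (norm_powerSeries_term_le hC hM hc hy le_rfl le_rfl)

theorem norm_powerSeries_le {μ b : ℝ} (hμ : 1 ≤ μ) {c : ℕ → ℂ} (hc : GeomBounded c) {Y : ℝ} :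
    ∃ K : ℝ, 0 ≤ K ∧ ∀ y, 0 < y → y ≤ Y → ‖powerSeries μ b c y‖ ≤ K * y ^ (b - 1) := by
  obtain ⟨C, M, hC, hM, hc⟩ := hc
  refine ⟨∑' n : ℕ, C * ((M * |Y| ^ μ) ^ n / |Real.Gamma (μ * n + b)|),
    tsum_nonneg fun n => by positivity, fun y hy hyY => ?_⟩
  have hs := (summable_pow_div_abs_Gamma hμ b (M * |Y| ^ μ) (by positivity)).mul_left
    (C * y ^ (b - 1))
  have hY : y ^ μ ≤ |Y| ^ μ :=
    Real.rpow_le_rpow hy.le (hyY.trans (le_abs_self Y)) (by linarith)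
  refine (tsum_of_norm_bounded hs.hasSum
    (norm_powerSeries_term_le hC hM hc hy le_rfl hY)).trans_eq ?_
  rw [← tsum_mul_right]
  congr 1
  funext n
  ring

theorem powerSeries_eq_add_shift {μ b : ℝ} (hμ : 1 ≤ μ) {c : ℕ → ℂ} (hc : GeomBounded c) {y : ℝ}
    (hy : 0 < y) :
    powerSeries μ b c y = c 0 * ((y ^ (b - 1) / Real.Gamma b : ℝ) : ℂ) +
      powerSeries μ (b + μ) (fun n => c (n + 1)) y := by
  rw [powerSeries, (summable_powerSeries hμ hc hy).tsum_eq_zero_add, powerSeries]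
  congr 1
  · simp
  · congr 1
    funext n
    push_cast
    ring_nf

/-- Termwise differentiation on `(y/2, 2y)`, where the differentiated series is dominated uniformly.
No condition on `b` is needed. -/
theorem hasDerivAt_powerSeries {μ b : ℝ} (hμ : 1 ≤ μ) {c : ℕ → ℂ} (hc : GeomBounded c) {y : ℝ}
    (hy : 0 < y) : HasDerivAt (powerSeries μ b c) (powerSeries μ (b - 1) c y) y := by
  have hc' := hc
  obtain ⟨C, M, hC, hM, hc⟩ := hc
  -- The sum of the endpoint values bounds `t^{b-2}` on the interval whatever the sign of the
  -- exponent.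
  set K : ℝ := (y / 2) ^ (b - 1 - 1) + (2 * y) ^ (b - 1 - 1) with hK
  have hy2 : 0 < y / 2 := by positivity
  change HasDerivAt (fun t => powerSeries μ b c t) _ _
  simp only [powerSeries]
  refine hasDerivAt_tsum_of_isPreconnected (t := Set.Ioo (y / 2) (2 * y))
    (g := fun n t => c n * ((t ^ (μ * n + b - 1) / Real.Gamma (μ * n + b) : ℝ) : ℂ))
    (g' := fun n t => c n * ((t ^ (μ * n + (b - 1) - 1) / Real.Gamma (μ * n + (b - 1)) : ℝ) : ℂ))
    (u := fun n : ℕ => C * K * ((M * (2 * y) ^ μ) ^ n / |Real.Gamma (μ * n + (b - 1))|))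
    ((summable_pow_div_abs_Gamma hμ (b - 1) _ (by positivity)).mul_left _) isOpen_Ioo
    isPreconnected_Ioo (fun n t ht => ?_) (fun n t ht => ?_)
    (y₀ := y) ⟨by linarith, by linarith⟩ (summable_powerSeries hμ hc' hy)
    ⟨by linarith, by linarith⟩
  · have ht0 : 0 < t := hy2.trans ht.1
    have h1 := (Real.hasDerivAt_rpow_const (p := μ * n + b - 1) (Or.inl ht0.ne')).div_const
      (Real.Gamma (μ * n + b))
    have h2 : (μ * n + b - 1) * t ^ (μ * n + b - 1 - 1) / Real.Gamma (μ * n + b) =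
        t ^ (μ * n + (b - 1) - 1) / Real.Gamma (μ * n + (b - 1)) := by
      rw [show μ * n + (b - 1) - 1 = μ * n + b - 1 - 1 by ring,
        show μ * n + (b - 1) = μ * n + b - 1 by ring]
      by_cases h0 : μ * n + b - 1 = 0
      · simp [h0]
      · have := Real.Gamma_add_one h0
        rw [sub_add_cancel] at this
        rw [this, mul_div_mul_left _ _ h0]
    rw [h2] at h1
    exact HasDerivAt.const_mul (c n) (HasDerivAt.ofReal_comp h1)
  · have ht0 : 0 < t := hy2.trans ht.1
    refine norm_powerSeries_term_le hC hM hc ht0 ?_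
      (Real.rpow_le_rpow ht0.le ht.2.le (by linarith)) n
    rcases le_total 0 (b - 1 - 1) with h | h
    · have := Real.rpow_le_rpow ht0.le ht.2.le h
      have : 0 < (y / 2) ^ (b - 1 - 1) := Real.rpow_pos_of_pos hy2 _
      linarith
    · have := Real.rpow_le_rpow_of_nonpos hy2 ht.1.le h
      have : 0 < (2 * y) ^ (b - 1 - 1) := by positivity
      linarith

theorem tendsto_powerSeries_zero {μ b : ℝ} (hμ : 1 ≤ μ) {c : ℕ → ℂ} (hc : GeomBounded c)
    (hb : 1 < b) : Tendsto (powerSeries μ b c) (𝓝[>] 0) (𝓝 0) := by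
  obtain ⟨K, hK, h⟩ := norm_powerSeries_le (b := b) hμ hc (Y := 1)
  have h1 : Tendsto (fun y : ℝ => K * y ^ (b - 1)) (𝓝[>] 0) (𝓝 0) := by
    have h2 : Tendsto (fun y : ℝ => K * y ^ (b - 1)) (𝓝 0) (𝓝 (K * 0 ^ (b - 1))) :=
      ((Real.continuous_rpow_const (by linarith)).tendsto 0).const_mul K
    rw [Real.zero_rpow (by linarith), mul_zero] at h2
    exact h2.mono_left nhdsWithin_le_nhds
  refine squeeze_zero_norm' ?_ h1
  filter_upwards [Ioc_mem_nhdsGT (zero_lt_one' ℝ)] with y hy using h y hy.1 hy.2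

theorem tendsto_powerSeries_one {μ : ℝ} (hμ : 1 ≤ μ) {c : ℕ → ℂ} (hc : GeomBounded c) :
    Tendsto (powerSeries μ 1 c) (𝓝[>] 0) (𝓝 (c 0)) := by
  have h := (tendsto_powerSeries_zero hμ hc.shift (b := 1 + μ) (by linarith)).const_add (c 0)
  rw [add_zero] at h
  refine h.congr' ?_
  filter_upwards [self_mem_nhdsWithin] with y hy
  rw [powerSeries_eq_add_shift hμ hc hy]
  simp

theorem continuousOn_powerSeries {μ b : ℝ} (hμ : 1 ≤ μ) {c : ℕ → ℂ} (hc : GeomBounded c) :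
    ContinuousOn (powerSeries μ b c) (Set.Ioi 0) := fun _ hy =>
  (hasDerivAt_powerSeries hμ hc hy).continuousAt.continuousWithinAt

/-! ### Riemann–Liouville integrals of such series -/

theorem rlConverges_powerSeries {μ b γ : ℝ} (hμ : 1 ≤ μ) {c : ℕ → ℂ} (hc : GeomBounded c)
    (hb : 0 < b) (hγ : 0 ≤ γ) {y : ℝ} (hy : 0 < y) : RLConverges γ (powerSeries μ b c) y := by
  rcases hγ.eq_or_lt with h | hγ
  · exact Or.inl h.symm
  right
  obtain ⟨K, hK, h⟩ := norm_powerSeries_le (b := b) hμ hc (Y := y)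
  have h1 := (intervalIntegrable_rpow_mul_rpow hγ hb hy).const_mul K
  rw [intervalIntegrable_iff_integrableOn_Ioo_of_le hy.le] at h1 ⊢
  refine h1.mono' ?_ ?_
  · refine ContinuousOn.aestronglyMeasurable ?_ measurableSet_Ioo
    refine ContinuousOn.mul ?_ ((continuousOn_powerSeries hμ hc).mono fun t ht => ht.1)
    refine Complex.continuous_ofReal.comp_continuousOn ?_
    exact ContinuousOn.rpow_const (by fun_prop) fun t ht => Or.inl (sub_pos.2 ht.2).ne'
  · refine (ae_restrict_mem measurableSet_Ioo).mono fun t ht => ?_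
    have h2 : 0 ≤ (y - t) ^ (γ - 1) := Real.rpow_nonneg (sub_nonneg.2 ht.2.le) _
    rw [norm_mul, Complex.norm_real, Real.norm_of_nonneg h2]
    calc _ ≤ (y - t) ^ (γ - 1) * (K * t ^ (b - 1)) := by
          gcongr
          exact h t ht.1 ht.2.le
      _ = _ := by ring

theorem rlInt_powerSeries {μ b γ : ℝ} (hμ : 1 ≤ μ) {c : ℕ → ℂ} (hc : GeomBounded c)
    (hb : 0 < b) (hγ : 0 ≤ γ) {y : ℝ} (hy : 0 < y) :
    rlInt γ (powerSeries μ b c) y = powerSeries μ (b + γ) c y := by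
  rcases hγ.eq_or_lt with h | hγ
  · simp [rlInt, ← h]
  have hμ0 : 0 < μ := by linarith
  have hpos : ∀ n : ℕ, 0 < μ * n + b := fun n => by positivity
  have hΓ := Real.Gamma_pos_of_pos hγ
  rw [rlInt, if_neg hγ.ne']
  set w : ℕ → ℝ → ℝ := fun n t => (y - t) ^ (γ - 1) * t ^ (μ * n + b - 1) with hw
  have hwi : ∀ n, IntervalIntegrable (w n) volume 0 y := fun n =>
    intervalIntegrable_rpow_mul_rpow hγ (hpos n) hy
  have hwint : ∀ n, ∫ t in (0 : ℝ)..y, w n t = y ^ (μ * n + (b + γ) - 1) *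
      (Real.Gamma γ * Real.Gamma (μ * n + b) / Real.Gamma (μ * n + (b + γ))) := fun n => by
    rw [hw, integral_rpow_mul_rpow hγ (hpos n) hy,
      show γ + (μ * n + b) = μ * n + (b + γ) by ring]
  have hwnn : ∀ n, ∀ t ∈ Set.Ioc 0 y, 0 ≤ w n t := fun n t ht =>
    mul_nonneg (Real.rpow_nonneg (sub_nonneg.2 ht.2) _) (Real.rpow_nonneg ht.1.le _)
  set F : ℕ → ℝ → ℂ := fun n t => c n * (((Real.Gamma (μ * n + b))⁻¹ : ℝ) : ℂ) * ((w n t : ℝ) : ℂ)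
    with hF
  have hFi : ∀ n, Integrable (F n) (volume.restrict (Set.Ioc 0 y)) := fun n =>
    (((intervalIntegrable_iff_integrableOn_Ioc_of_le hy.le).1 (hwi n)).ofReal).const_mul _
  -- The `L¹` norms are, up to the factor `Γ(γ)`, the norms of the terms of the target series, so
  -- its absolute convergence justifies exchanging sum and integral.
  have hFn : ∀ n, ∫ t in Set.Ioc 0 y, ‖F n t‖ = Real.Gamma γ *
      ‖c n * ((y ^ (μ * n + (b + γ) - 1) / Real.Gamma (μ * n + (b + γ)) : ℝ) : ℂ)‖ := fun n => by
    have h1 : ∫ t in Set.Ioc 0 y, ‖F n t‖ =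
        ∫ t in Set.Ioc 0 y, ‖c n‖ * (Real.Gamma (μ * n + b))⁻¹ * w n t := by
      refine setIntegral_congr_fun measurableSet_Ioc fun t ht => ?_
      simp only [hF, norm_mul, Complex.norm_real]
      rw [Real.norm_of_nonneg (hwnn n t ht),
        Real.norm_of_nonneg (inv_nonneg.2 (Real.Gamma_pos_of_pos (hpos n)).le)]
    rw [h1, integral_const_mul, ← intervalIntegral.integral_of_le hy.le, hwint, norm_mul,
      Complex.norm_real, Real.norm_of_nonneg]
    · have := (Real.Gamma_pos_of_pos (hpos n)).ne'
      field_simp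
    · have := Real.Gamma_pos_of_pos (show 0 < μ * n + (b + γ) by linarith [hpos n])
      positivity
  have hsum : Summable fun n => ∫ t in Set.Ioc 0 y, ‖F n t‖ := by
    simp_rw [hFn]
    exact ((summable_powerSeries hμ hc hy).norm).mul_left _
  have key := hasSum_integral_of_summable_integral_norm hFi hsum
  have e1 : ∫ t in (0 : ℝ)..y, (((y - t) ^ (γ - 1) : ℝ) : ℂ) * powerSeries μ b c t =
      ∫ t in Set.Ioc 0 y, ∑' n, F n t := by
    rw [intervalIntegral.integral_of_le hy.le]
    refine setIntegral_congr_fun measurableSet_Ioc fun t ht => ?_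
    simp only [powerSeries, hF, hw]
    rw [← tsum_mul_left]
    congr 1
    funext n
    push_cast
    ring
  have e2 : ∀ n, ∫ t in Set.Ioc 0 y, F n t = (Real.Gamma γ : ℂ) *
      (c n * ((y ^ (μ * n + (b + γ) - 1) / Real.Gamma (μ * n + (b + γ)) : ℝ) : ℂ)) := fun n => by
    have h1 : ∫ t in Set.Ioc 0 y, ((w n t : ℝ) : ℂ) = ((∫ t in Set.Ioc 0 y, w n t : ℝ) : ℂ) :=
      integral_ofReal
    simp only [hF]
    rw [integral_const_mul, h1, ← intervalIntegral.integral_of_le hy.le, hwint]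
    have : (Real.Gamma (μ * n + b) : ℂ) ≠ 0 := by
      exact_mod_cast (Real.Gamma_pos_of_pos (hpos n)).ne'
    push_cast
    field_simp
  rw [e1, ← key.tsum_eq]
  simp_rw [e2]
  rw [tsum_mul_left, ← mul_assoc, powerSeries]
  have : (Real.Gamma γ : ℂ) ≠ 0 := by exact_mod_cast hΓ.ne'
  push_cast
  rw [inv_mul_cancel₀ this, one_mul]

/-! ### Riemann–Liouville integrals of integrable functions -/

theorem rlInt_congr {γ : ℝ} {u w : ℝ → ℂ} {y : ℝ} (hy : 0 < y)
    (h : ∀ t, 0 < t → t ≤ y → u t = w t) : rlInt γ u y = rlInt γ w y := by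
  unfold rlInt
  split_ifs
  · exact h y hy le_rfl
  · congr 1
    rw [intervalIntegral.integral_of_le hy.le, intervalIntegral.integral_of_le hy.le]
    refine setIntegral_congr_fun measurableSet_Ioc fun t ht => ?_
    simp only [h t ht.1 ht.2]

theorem rlConverges_congr {γ : ℝ} {u w : ℝ → ℂ} {y : ℝ} (hy : 0 < y)
    (h : ∀ t, 0 < t → u t = w t) : RLConverges γ u y ↔ RLConverges γ w y := by
  unfold RLConverges
  rw [intervalIntegrable_iff_integrableOn_Ioc_of_le hy.le,
    intervalIntegrable_iff_integrableOn_Ioc_of_le hy.le]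
  refine or_congr_right (integrableOn_congr_fun (fun t ht => ?_) measurableSet_Ioc)
  simp only [h t ht.1]

theorem rlInt_zero (u : ℝ → ℂ) : rlInt 0 u = u := by
  funext y
  simp [rlInt]

theorem rlInt_one (u : ℝ → ℂ) (y : ℝ) : rlInt 1 u y = ∫ t in (0 : ℝ)..y, u t := by
  simp [rlInt]

/-- Fubini on the triangle `s < t < y`, the inner integral being a Beta integral. The condition `1 ≤
a + b` makes the resulting kernel `(y-s)^{a+b-1}` bounded, so the identity holds at every `y` for
integrable `u`, not just almost everywhere. -/
theorem rlInt_rlInt {a b : ℝ} (ha : 0 < a) (hb : 0 ≤ b) (hab : 1 ≤ a + b) {u : ℝ → ℂ} {y : ℝ}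
    (hy : 0 < y) (hu : IntegrableOn u (Set.Ioc 0 y)) :
    rlInt a (rlInt b u) y = rlInt (a + b) u y := by
  rcases hb.eq_or_lt with h | hb
  · rw [← h, rlInt_zero, add_zero]
  set m : Measure ℝ := volume.restrict (Set.Ioo 0 y) with hm
  have hu' : Integrable u m := hu.mono_set Set.Ioo_subset_Ioc_self
  set B : ℝ := Real.Gamma a * Real.Gamma b / Real.Gamma (a + b) with hB
  have hmem : ∀ᵐ s ∂m, s ∈ Set.Ioo 0 y := ae_restrict_mem measurableSet_Ioo
  let w : ℝ → ℝ → ℝ := fun t s => if s < t then (y - t) ^ (a - 1) * (t - s) ^ (b - 1) else 0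
  have hwm : Measurable fun p : ℝ × ℝ => w p.1 p.2 := by
    refine Measurable.ite (measurableSet_lt measurable_snd measurable_fst) ?_ measurable_const
    fun_prop
  have hwind : ∀ s ∈ Set.Ioo 0 y, ∀ t ∈ Set.Ioo 0 y, w t s =
      (Set.Ioc s y).indicator (fun t => (y - t) ^ (a - 1) * (t - s) ^ (b - 1)) t := by
    intro s hs t ht
    by_cases h : s < t
    · rw [Set.indicator_of_mem (show t ∈ Set.Ioc s y from ⟨h, ht.2.le⟩)]
      simp [w, h]
    · rw [Set.indicator_of_notMem fun h' : t ∈ Set.Ioc s y => h h'.1]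
      simp [w, h]
  have hsub : ∀ s ∈ Set.Ioo 0 y, Set.Ioo 0 y ∩ Set.Ioc s y = Set.Ioo s y := by
    intro s hs
    ext t
    constructor
    · rintro ⟨h1, h2⟩
      exact ⟨h2.1, h1.2⟩
    · rintro ⟨h1, h2⟩
      exact ⟨⟨hs.1.trans h1, h2⟩, h1, h2.le⟩
  have hwnn : ∀ s ∈ Set.Ioo 0 y, ∀ t ∈ Set.Ioo 0 y, 0 ≤ w t s := by
    intro s hs t ht
    simp only [w]
    split_ifs with h
    · exact mul_nonneg (Real.rpow_nonneg (sub_nonneg.2 ht.2.le) _)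
        (Real.rpow_nonneg (sub_nonneg.2 h.le) _)
    · rfl
  have hwi : ∀ s ∈ Set.Ioo 0 y, Integrable (fun t => w t s) m := by
    intro s hs
    refine (integrableOn_congr_fun (hwind s hs) measurableSet_Ioo).2 ?_
    rw [IntegrableOn, integrable_indicator_iff measurableSet_Ioc, IntegrableOn,
      Measure.restrict_restrict measurableSet_Ioc, Set.inter_comm, hsub s hs]
    exact (intervalIntegrable_iff_integrableOn_Ioo_of_le hs.2.le).1
      (intervalIntegrable_rpow_mul_rpow_sub ha hb hs.2)
  have hwint : ∀ s ∈ Set.Ioo 0 y, ∫ t, w t s ∂m = (y - s) ^ (a + b - 1) * B := by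
    intro s hs
    rw [hm, setIntegral_congr_fun measurableSet_Ioo (hwind s hs),
      setIntegral_indicator measurableSet_Ioc, hsub s hs, ← integral_Ioc_eq_integral_Ioo,
      ← intervalIntegral.integral_of_le hs.2.le, integral_rpow_mul_rpow_sub ha hb hs.2]
  have hfi : Integrable (fun p : ℝ × ℝ => ((w p.1 p.2 : ℝ) : ℂ) * u p.2) (m.prod m) := by
    refine (integrable_prod_iff' ?_).2 ⟨?_, ?_⟩
    · exact (Complex.measurable_ofReal.comp hwm).aestronglyMeasurable.mul hu'.1.comp_snd
    · filter_upwards [hmem] with s hs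
      exact (hwi s hs).ofReal.mul_const _
    · have h1 : Integrable (fun s => ((y - s) ^ (a + b - 1) * B) * ‖u s‖) m := by
        refine hu'.norm.bdd_mul (c := y ^ (a + b - 1) * B) ?_ ?_
        · exact Measurable.aestronglyMeasurable (by fun_prop)
        · filter_upwards [hmem] with s hs
          have : 0 ≤ B := by
            have := Real.Gamma_pos_of_pos ha
            have := Real.Gamma_pos_of_pos hb
            have := Real.Gamma_pos_of_pos (add_pos ha hb)
            positivity
          have h2 : 0 ≤ y - s := sub_nonneg.2 hs.2.le
          rw [Real.norm_of_nonneg (by positivity)]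
          gcongr
          linarith [hs.1]
      refine h1.congr ?_
      filter_upwards [hmem] with s hs
      rw [← hwint s hs, ← integral_mul_const]
      refine integral_congr_ae ?_
      filter_upwards [hmem] with t ht
      rw [norm_mul, Complex.norm_real, Real.norm_of_nonneg (hwnn s hs t ht)]
  have key := integral_integral_swap (f := fun t s => ((w t s : ℝ) : ℂ) * u s) hfi
  have e1 : ∫ s, ∫ t, ((w t s : ℝ) : ℂ) * u s ∂m ∂m =
      (B : ℂ) * ∫ s in (0 : ℝ)..y, (((y - s) ^ (a + b - 1) : ℝ) : ℂ) * u s := by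
    rw [intervalIntegral.integral_of_le hy.le, integral_Ioc_eq_integral_Ioo,
      ← integral_const_mul]
    refine integral_congr_ae ?_
    filter_upwards [hmem] with s hs
    rw [integral_mul_const, show ∫ t, ((w t s : ℝ) : ℂ) ∂m = ((∫ t, w t s ∂m : ℝ) : ℂ) from
      integral_ofReal, hwint s hs]
    push_cast
    ring
  have e2 : ∫ t, ∫ s, ((w t s : ℝ) : ℂ) * u s ∂m ∂m = ∫ t in (0 : ℝ)..y,
      (((y - t) ^ (a - 1) : ℝ) : ℂ) *
        ∫ s in (0 : ℝ)..t, (((t - s) ^ (b - 1) : ℝ) : ℂ) * u s := by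
    rw [intervalIntegral.integral_of_le hy.le, integral_Ioc_eq_integral_Ioo]
    refine integral_congr_ae ?_
    filter_upwards [hmem] with t ht
    rw [intervalIntegral.integral_of_le ht.1.le, integral_Ioc_eq_integral_Ioo,
      ← integral_const_mul]
    have h1 : Set.Ioo 0 y ∩ Set.Iio t = Set.Ioo 0 t := by
      ext s
      constructor
      · rintro ⟨h1, h2⟩
        exact ⟨h1.1, h2⟩
      · rintro ⟨h1, h2⟩
        exact ⟨⟨h1, h2.trans ht.2⟩, h2⟩
    rw [← h1, ← setIntegral_indicator measurableSet_Iio, hm]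
    congr 1
    funext s
    by_cases h : s < t
    · rw [Set.indicator_of_mem (Set.mem_Iio.2 h)]
      simp [w, h, mul_assoc]
    · rw [Set.indicator_of_notMem (by simpa using h)]
      simp [w, h]
  rw [e1, e2] at key
  have hae : (Real.Gamma a : ℂ) ≠ 0 := by exact_mod_cast (Real.Gamma_pos_of_pos ha).ne'
  have hbe : (Real.Gamma b : ℂ) ≠ 0 := by exact_mod_cast (Real.Gamma_pos_of_pos hb).ne'
  have hb0 : b ≠ 0 := hb.ne'
  simp only [rlInt, if_neg ha.ne', if_neg hb0, if_neg (add_pos ha hb).ne']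
  have e3 : ∫ t in (0 : ℝ)..y, (((y - t) ^ (a - 1) : ℝ) : ℂ) *
      ((((Real.Gamma b)⁻¹ : ℝ) : ℂ) * ∫ s in (0 : ℝ)..t, (((t - s) ^ (b - 1) : ℝ) : ℂ) * u s) =
      (((Real.Gamma b)⁻¹ : ℝ) : ℂ) * ∫ t in (0 : ℝ)..y, (((y - t) ^ (a - 1) : ℝ) : ℂ) *
        ∫ s in (0 : ℝ)..t, (((t - s) ^ (b - 1) : ℝ) : ℂ) * u s := by
    rw [← intervalIntegral.integral_const_mul]
    congr 1
    funext t
    ring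
  rw [e3, key, hB]
  push_cast
  field_simp

theorem norm_rlInt_le {a : ℝ} (ha : 1 ≤ a) {u : ℝ → ℂ} {y : ℝ} (hy : 0 < y)
    (hu : IntegrableOn u (Set.Ioc 0 y)) :
    ‖rlInt a u y‖ ≤ y ^ (a - 1) / Real.Gamma a * ∫ t in Set.Ioc 0 y, ‖u t‖ := by
  have ha0 : 0 < a := by linarith
  have hΓ := Real.Gamma_pos_of_pos ha0
  rw [rlInt, if_neg ha0.ne', norm_mul, Complex.norm_real, Real.norm_of_nonneg (by positivity),
    div_eq_inv_mul, mul_assoc, intervalIntegral.integral_of_le hy.le, ← integral_const_mul]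
  gcongr
  refine norm_integral_le_of_norm_le (hu.norm.const_mul _) ?_
  refine (ae_restrict_mem measurableSet_Ioc).mono fun t ht => ?_
  have h2 : 0 ≤ y - t := sub_nonneg.2 ht.2
  rw [norm_mul, Complex.norm_real, Real.norm_of_nonneg (by positivity)]
  gcongr
  linarith [ht.1]

theorem integrableOn_rlInt_one {u : ℝ → ℂ} {y : ℝ} (hy : 0 < y)
    (hu : IntegrableOn u (Set.Ioc 0 y)) : IntegrableOn (rlInt 1 u) (Set.Ioc 0 y) := by
  have h : ContinuousOn (fun t => ∫ s in (0 : ℝ)..t, u s) (Set.uIcc 0 y) :=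
    intervalIntegral.continuousOn_primitive_interval
      (by rwa [Set.uIcc_of_le hy.le, integrableOn_Icc_iff_integrableOn_Ioc])
  rw [Set.uIcc_of_le hy.le] at h
  rw [show rlInt 1 u = fun t => ∫ s in (0 : ℝ)..t, u s from funext fun t => rlInt_one u t]
  exact (h.integrableOn_Icc).mono_set Set.Ioc_subset_Icc_self

/-- Convergence is used at `y + 1`: on `[0, y]` the kernel `(y+1-t)^{γ-1}` stays away from its
singularity and can be divided out. -/
theorem integrableOn_of_rlConverges {γ : ℝ} (hγ : γ ≠ 0) {q : ℝ → ℂ}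
    (h : ∀ y, 0 < y → RLConverges γ q y) {y : ℝ} (hy : 0 < y) :
    IntegrableOn q (Set.Ioc 0 y) := by
  have h1 := (h (y + 1) (by linarith)).resolve_left hγ
  rw [intervalIntegrable_iff_integrableOn_Ioc_of_le (by linarith)] at h1
  have h2 := h1.mono_set (Set.Ioc_subset_Ioc_right (by linarith : y ≤ y + 1))
  rw [← integrableOn_Icc_iff_integrableOn_Ioc] at h2 ⊢
  have h3 : ContinuousOn (fun t : ℝ => (((y + 1 - t) ^ (1 - γ) : ℝ) : ℂ)) (Set.Icc 0 y) := by
    refine Complex.continuous_ofReal.comp_continuousOn ?_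
    exact ContinuousOn.rpow_const (by fun_prop) fun t ht => Or.inl (by linarith [ht.2])
  refine (integrableOn_congr_fun (fun t ht => ?_) measurableSet_Icc).1
    (h2.continuousOn_mul h3 isCompact_Icc)
  have h4 : 0 < y + 1 - t := by linarith [ht.2]
  rw [← mul_assoc, ← Complex.ofReal_mul, ← Real.rpow_add h4]
  simp

/-- Two-fold integration of the Hilfer derivative, smoothed by one further integration. -/
theorem rlInt_eq_of_hilfer {γ₀ γ₁ : ℝ} (h₀ : 0 ≤ γ₀) (h₁ : 0 ≤ γ₁) (h₁' : γ₁ < 1)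
    {u : ℝ → ℂ} (hu : ∀ y, 0 < y → IntegrableOn u (Set.Ioc 0 y))
    (hp : ∀ y, 0 < y → DifferentiableAt ℝ (rlInt γ₀ u) y)
    (hp' : ∀ y, 0 < y → DifferentiableAt ℝ (deriv (rlInt γ₀ u)) y)
    (hc : ∀ y, 0 < y → RLConverges γ₁ (deriv (deriv (rlInt γ₀ u))) y)
    {v : ℝ → ℂ} (hv : ∀ y, 0 < y → IntegrableOn v (Set.Ioc 0 y))
    (huv : ∀ y, 0 < y → rlInt γ₁ (deriv (deriv (rlInt γ₀ u))) y = v y)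
    {f g : ℂ} (hf : Tendsto (rlInt γ₀ u) (𝓝[>] 0) (𝓝 f))
    (hg : Tendsto (deriv (rlInt γ₀ u)) (𝓝[>] 0) (𝓝 g)) {y : ℝ} (hy : 0 < y) :
    IntegrableOn (rlInt γ₀ u) (Set.Ioc 0 y) ∧
      rlInt (1 + γ₀) u y = f * y + g * (y ^ 2 / 2) + rlInt (3 - γ₁) v y := by
  set p := rlInt γ₀ u with hpdef
  set q := deriv (deriv p) with hq
  have hqi : ∀ y, 0 < y → IntegrableOn q (Set.Ioc 0 y) := by
    intro y hy
    -- For `γ₁ = 0` the convergence hypothesis says nothing, but then `q` is `v` itself.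
    by_cases h : γ₁ = 0
    · refine (integrableOn_congr_fun (fun t ht => ?_) measurableSet_Ioc).1 (hv y hy)
      rw [← huv t ht.1, h, rlInt_zero]
    · exact integrableOn_of_rlConverges h hc hy
  have e1 : ∀ t, 0 < t → deriv p t = g + rlInt 1 q t := by
    intro t ht
    have := intervalIntegral.integral_eq_sub_of_hasDerivAt_of_tendsto ht
      (fun x hx => (hp' x hx.1).hasDerivAt)
      ((intervalIntegrable_iff_integrableOn_Ioc_of_le ht.le).2 (hqi t ht)) hg
      ((hp' t ht).continuousAt.tendsto.mono_left nhdsWithin_le_nhds)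
    rw [rlInt_one, this]
    ring
  have e2 : ∀ t, 0 < t → p t = f + g * t + rlInt 2 q t := by
    intro t ht
    have hi1 : IntegrableOn (fun _ : ℝ => g) (Set.Ioc 0 t) := by simp
    have hi2 := integrableOn_rlInt_one ht (hqi t ht)
    have hi : IntegrableOn (deriv p) (Set.Ioc 0 t) :=
      (integrableOn_congr_fun (fun s hs => e1 s hs.1) measurableSet_Ioc).2 (hi1.add hi2)
    have := intervalIntegral.integral_eq_sub_of_hasDerivAt_of_tendsto ht
      (fun x hx => (hp x hx.1).hasDerivAt)
      ((intervalIntegrable_iff_integrableOn_Ioc_of_le ht.le).2 hi) hf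
      ((hp t ht).continuousAt.tendsto.mono_left nhdsWithin_le_nhds)
    have h3 : ∫ s in (0 : ℝ)..t, deriv p s = g * t + rlInt 2 q t := by
      rw [show (2 : ℝ) = 1 + 1 by norm_num, ← rlInt_rlInt one_pos zero_le_one (by norm_num) ht
        (hqi t ht), rlInt_one, intervalIntegral.integral_of_le ht.le,
        intervalIntegral.integral_of_le ht.le,
        setIntegral_congr_fun measurableSet_Ioc (fun s hs => e1 s hs.1), integral_add hi1 hi2]
      simp [ht.le, mul_comm]
    rw [h3] at this
    rw [show p t = p t - f + f by ring, ← this]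
    ring
  have hi0 : IntegrableOn (fun _ : ℝ => f) (Set.Ioc 0 y) := by simp
  have hi1 : IntegrableOn (fun t : ℝ => g * t) (Set.Ioc 0 y) :=
    (Continuous.integrableOn_Icc (by fun_prop)).mono_set Set.Ioc_subset_Icc_self
  have hi2 : IntegrableOn (rlInt 2 q) (Set.Ioc 0 y) := by
    refine (integrableOn_congr_fun (fun t ht => ?_) measurableSet_Ioc).1
      (integrableOn_rlInt_one hy (integrableOn_rlInt_one hy (hqi y hy)))
    rw [rlInt_rlInt one_pos zero_le_one (by norm_num) ht.1 (hqi t ht.1)]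
    norm_num
  refine ⟨(integrableOn_congr_fun (fun s hs => e2 s hs.1) measurableSet_Ioc).2
    ((hi0.add hi1).add hi2), ?_⟩
  have e3 : ∫ t in (0 : ℝ)..y, g * (t : ℂ) = g * (y ^ 2 / 2) := by
    rw [intervalIntegral.integral_const_mul, intervalIntegral.integral_ofReal, integral_id]
    push_cast
    ring
  -- The left side is `I¹ p`. On the right, `I¹ I² q = I³ q = I^{3-γ₁} I^{γ₁} q`, and `I^{γ₁} q` is
  -- `v`.
  rw [← rlInt_rlInt one_pos h₀ (by linarith) hy (hu y hy), rlInt_one,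
    intervalIntegral.integral_of_le hy.le,
    setIntegral_congr_fun measurableSet_Ioc (fun s hs => e2 s hs.1),
    integral_add (f := fun t : ℝ => f + g * t) (hi0.add hi1) hi2, integral_add hi0 hi1,
    ← intervalIntegral.integral_of_le hy.le, ← intervalIntegral.integral_of_le hy.le,
    ← intervalIntegral.integral_of_le hy.le, e3, ← rlInt_one (rlInt 2 q),
    rlInt_rlInt one_pos (by norm_num) (by norm_num) hy (hqi y hy),
    ← rlInt_congr hy (fun t ht _ => huv t ht),
    rlInt_rlInt (by linarith) h₁ (by linarith) hy (hqi y hy)]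
  simp only [intervalIntegral.integral_const, sub_zero, Complex.real_smul]
  rw [sub_add_cancel, show (1 : ℝ) + 2 = 3 by norm_num]
  ring

/-! ### Fourier transforms of test functions -/

open scoped FourierTransform in
theorem fourierHat_neg_eq (φ : 𝓢(ℝ, ℂ)) (κ : ℝ) :
    fourierHat φ (-κ) = 𝓕 φ (κ / (2 * Real.pi)) := by
  rw [SchwartzMap.fourier_coe, Real.fourier_eq', fourierHat]
  congr 1
  funext x
  rw [smul_eq_mul, mul_comm]
  congr 2
  simp only [RCLike.inner_apply, conj_trivial]
  push_cast
  have : (Real.pi : ℂ) ≠ 0 := by exact_mod_cast Real.pi_ne_zero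
  field_simp

/-- The function `κ ↦ φ̂(-κ)`. -/
def dualHat (φ : TestSpace) (κ : ℝ) : ℂ := fourierHat (φ : 𝓢(ℝ, ℂ)) (-κ)

theorem continuous_dualHat (φ : TestSpace) : Continuous (dualHat φ) := by
  rw [show dualHat φ = _ from funext fun κ => fourierHat_neg_eq φ κ]
  exact (SchwartzMap.continuous _).comp (by fun_prop)

theorem hasCompactSupport_dualHat (φ : TestSpace) : HasCompactSupport (dualHat φ) :=
  HasCompactSupport.comp_homeomorph φ.2 (Homeomorph.neg ℝ)

theorem exists_dualHat_eq_zero (φ : TestSpace) :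
    ∃ R : ℝ, 0 < R ∧ ∀ κ, κ ∉ Set.Icc (-R) R → dualHat φ κ = 0 := by
  obtain ⟨R, hR⟩ := (hasCompactSupport_dualHat φ).isBounded.subset_closedBall 0
  refine ⟨max R 1, by positivity, fun κ hκ => image_eq_zero_of_notMem_tsupport fun h => hκ ?_⟩
  have := hR h
  rw [mem_closedBall_zero_iff, Real.norm_eq_abs] at this
  exact abs_le.1 (this.trans (le_max_left _ _))

theorem exists_norm_dualHat_le (φ : TestSpace) : ∃ C : ℝ, 0 ≤ C ∧ ∀ κ, ‖dualHat φ κ‖ ≤ C := by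
  obtain ⟨C, hC⟩ := (hasCompactSupport_dualHat φ).exists_bound_of_continuous (continuous_dualHat φ)
  exact ⟨C, (norm_nonneg _).trans (hC 0), hC⟩

theorem dualHat_add (φ χ : TestSpace) (κ : ℝ) :
    dualHat (φ + χ) κ = dualHat φ κ + dualHat χ κ := by
  simp only [dualHat, fourierHat_neg_eq, Submodule.coe_add, FourierTransform.fourier_add,
    add_apply]

theorem dualHat_smul (c : ℂ) (φ : TestSpace) (κ : ℝ) : dualHat (c • φ) κ = c * dualHat φ κ := by
  simp only [dualHat, fourierHat_neg_eq, Submodule.coe_smul, FourierTransform.fourier_smul,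
    smul_apply, smul_eq_mul]

theorem dualHat_translate (h : ℝ) (φ : TestSpace) (κ : ℝ) :
    dualHat (translate h φ) κ = Complex.exp (-(Complex.I * κ * h)) * dualHat φ κ := by
  have e := integral_sub_right_eq_self (μ := volume)
    (fun x : ℝ => (φ : 𝓢(ℝ, ℂ)) x * Complex.exp (Complex.I * (-κ : ℝ) * ((x + h : ℝ) : ℂ))) h
  simp only [sub_add_cancel] at e
  simp only [dualHat, fourierHat, translate, SchwartzMap.compSubConstCLM_apply]
  rw [e, ← integral_const_mul]
  congr 1
  funext x
  rw [show Complex.I * (-κ : ℝ) * ((x + h : ℝ) : ℂ)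
    = -(Complex.I * κ * h) + Complex.I * (-κ : ℝ) * x by push_cast; ring, Complex.exp_add]
  ring

open scoped FourierTransform ContDiff in
-- Inverse Fourier transform of a rescaled `g`. It supplies enough test functions for the
-- fundamental lemma of the calculus of variations, for which real-valued `g` suffice.
theorem exists_dualHat_eq {g : ℝ → ℝ} (hg : ContDiff ℝ ∞ g) (hg' : HasCompactSupport g) :
    ∃ φ : TestSpace, ∀ κ, dualHat φ κ = g κ := by
  have hπ : (2 * Real.pi) ≠ 0 := by positivity
  have h1 : ContDiff ℝ ∞ (fun ξ : ℝ => ((g (ξ * (2 * Real.pi)) : ℝ) : ℂ)) :=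
    Complex.ofRealCLM.contDiff.comp (hg.comp (by fun_prop))
  have h2 : HasCompactSupport (fun ξ : ℝ => ((g (ξ * (2 * Real.pi)) : ℝ) : ℂ)) := by
    have := (hg'.comp_homeomorph (Homeomorph.mulRight₀ (2 * Real.pi) hπ)).comp_left
      (g := fun x : ℝ => (x : ℂ)) (by simp)
    exact this
  set φ : 𝓢(ℝ, ℂ) := 𝓕⁻ (h2.toSchwartzMap h1) with hφ
  have key : ∀ κ, fourierHat φ (-κ) = g κ := fun κ => by
    rw [fourierHat_neg_eq, hφ, FourierTransform.fourier_fourierInv_eq]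
    simp only [HasCompactSupport.toSchwartzMap_toFun]
    rw [div_mul_cancel₀ _ hπ]
  refine ⟨⟨φ, ?_⟩, key⟩
  change HasCompactSupport (fourierHat φ)
  have h3 : fourierHat φ = fun κ => ((g (-κ) : ℝ) : ℂ) := by
    funext κ
    rw [← key, neg_neg]
  rw [h3]
  exact (hg'.comp_homeomorph (Homeomorph.neg ℝ)).comp_left (g := fun x : ℝ => (x : ℂ)) (by simp)

/-! ### Fourier integrals as generalized functions -/

theorem fourierIntegral_eq (h : ℝ → ℂ) (φ : TestSpace) :
    fourierIntegral h φ = (2 * Real.pi : ℂ)⁻¹ * ∫ κ : ℝ, h κ * dualHat φ κ := rfl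

theorem integrable_mul_dualHat {h : ℝ → ℂ} (hh : LocallyIntegrable h) (φ : TestSpace) :
    Integrable fun κ => h κ * dualHat φ κ :=
  hh.integrable_smul_right_of_hasCompactSupport (continuous_dualHat φ)
    (hasCompactSupport_dualHat φ)

theorem locallyIntegrable_continuous_mul {h c : ℝ → ℂ} (hc : Continuous c)
    (hh : LocallyIntegrable h) : LocallyIntegrable fun κ => c κ * h κ := by
  rw [← locallyIntegrableOn_univ] at hh ⊢
  exact hh.continuousOn_mul hc.continuousOn isOpen_univ.isLocallyClosed

theorem fourierIntegral_add {h₁ h₂ : ℝ → ℂ} (hh₁ : LocallyIntegrable h₁)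
    (hh₂ : LocallyIntegrable h₂) (φ : TestSpace) :
    fourierIntegral (fun κ => h₁ κ + h₂ κ) φ = fourierIntegral h₁ φ + fourierIntegral h₂ φ := by
  simp only [fourierIntegral_eq, add_mul]
  rw [integral_add (integrable_mul_dualHat hh₁ φ) (integrable_mul_dualHat hh₂ φ), mul_add]

theorem fourierIntegral_const_mul (c : ℂ) (h : ℝ → ℂ) (φ : TestSpace) :
    fourierIntegral (fun κ => c * h κ) φ = c * fourierIntegral h φ := by
  simp only [fourierIntegral_eq, mul_assoc]
  rw [integral_const_mul]
  ring

theorem fourierIntegral_congr_ae {h₁ h₂ : ℝ → ℂ} (h : h₁ =ᵐ[volume] h₂) (φ : TestSpace) :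
    fourierIntegral h₁ φ = fourierIntegral h₂ φ := by
  simp only [fourierIntegral_eq]
  congr 1
  exact integral_congr_ae (h.mono fun κ hκ => by simp only [hκ])

/-- The generalized function with the given locally integrable Fourier transform. -/
def genFunOf (h : ℝ → ℂ) (hh : LocallyIntegrable h) : GenFun where
  toFun := fourierIntegral h
  map_add' φ χ := by
    simp only [fourierIntegral_eq, dualHat_add, mul_add]
    rw [integral_add (integrable_mul_dualHat hh φ) (integrable_mul_dualHat hh χ), mul_add]
  map_smul' c φ := by
    simp only [fourierIntegral_eq, dualHat_smul, smul_eq_mul, RingHom.id_apply]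
    simp_rw [mul_left_comm _ c]
    rw [integral_const_mul]
    ring

theorem ae_eq_of_fourierIntegral_eq {h₁ h₂ : ℝ → ℂ} (hh₁ : LocallyIntegrable h₁)
    (hh₂ : LocallyIntegrable h₂) (h : ∀ φ, fourierIntegral h₁ φ = fourierIntegral h₂ φ) :
    h₁ =ᵐ[volume] h₂ := by
  refine ae_eq_of_integral_contDiff_smul_eq hh₁ hh₂ fun g hg hg' => ?_
  obtain ⟨φ, hφ⟩ := exists_dualHat_eq hg hg'
  have := h φ
  simp only [fourierIntegral_eq, hφ] at this
  have h2 : (2 * Real.pi : ℂ)⁻¹ ≠ 0 := by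
    have : (Real.pi : ℂ) ≠ 0 := by exact_mod_cast Real.pi_ne_zero
    simp [this]
  simpa only [Complex.real_smul, mul_comm] using mul_left_cancel₀ h2 this

theorem HasFourier.ae_eq {T : GenFun} {h₁ h₂ : ℝ → ℂ} (hh₁ : HasFourier T h₁)
    (hh₂ : HasFourier T h₂) : h₁ =ᵐ[volume] h₂ :=
  ae_eq_of_fourierIntegral_eq hh₁.1 hh₂.1 fun φ => by rw [← hh₁.2, hh₂.2]

open scoped FourierTransform in
-- Fourier inversion at the point 0.
theorem dirac_eq_fourierIntegral (φ : TestSpace) : dirac φ = fourierIntegral (fun _ => 1) φ := by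
  have h1 : ∫ κ : ℝ, dualHat φ κ = (2 * Real.pi : ℝ) * ∫ ξ : ℝ, (𝓕 (φ : 𝓢(ℝ, ℂ)) : 𝓢(ℝ, ℂ)) ξ := by
    simp only [dualHat, fourierHat_neg_eq]
    refine (Measure.integral_comp_div (fun ξ => (𝓕 (φ : 𝓢(ℝ, ℂ)) : 𝓢(ℝ, ℂ)) ξ)
      (2 * Real.pi)).trans ?_
    rw [abs_of_pos (by positivity), Complex.real_smul]
  have h2 : (φ : 𝓢(ℝ, ℂ)) 0 = ∫ ξ : ℝ, (𝓕 (φ : 𝓢(ℝ, ℂ)) : 𝓢(ℝ, ℂ)) ξ := by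
    have h3 : 𝓕⁻ (𝓕 (φ : 𝓢(ℝ, ℂ)) : 𝓢(ℝ, ℂ)) = (φ : 𝓢(ℝ, ℂ)) :=
      FourierTransform.fourierInv_fourier_eq _
    conv_lhs => rw [← h3]
    rw [SchwartzMap.fourierInv_coe, Real.fourierInv_eq]
    simp
  have : (Real.pi : ℂ) ≠ 0 := by exact_mod_cast Real.pi_ne_zero
  simp only [fourierIntegral_eq, one_mul]
  rw [h1, ← h2]
  push_cast
  rw [← mul_assoc, inv_mul_cancel₀ (by simp [this]), one_mul]
  rfl

open scoped FourierTransform in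
-- The Riemann–Lebesgue lemma. Integrability is not required: otherwise the integral is 0 for every
-- `x` by convention.
theorem tendsto_integral_mul_exp (h : ℝ → ℂ) :
    Tendsto (fun x : ℝ => ∫ κ : ℝ, h κ * Complex.exp (-(Complex.I * κ * x)))
      (cocompact ℝ) (𝓝 0) := by
  have hπ : (2 * Real.pi)⁻¹ ≠ 0 := by positivity
  have h1 := (Real.tendsto_integral_exp_smul_cocompact h).comp
    (Homeomorph.mulRight₀ ((2 * Real.pi)⁻¹) hπ).isClosedEmbedding.tendsto_cocompact
  refine h1.congr fun x => ?_
  change ∫ κ : ℝ, 𝐞 (-(κ * (x * (2 * Real.pi)⁻¹))) • h κ = _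
  congr 1
  funext κ
  rw [Circle.smul_def, Real.fourierChar_apply, smul_eq_mul, mul_comm]
  congr 2
  push_cast
  have : (Real.pi : ℂ) ≠ 0 := by exact_mod_cast Real.pi_ne_zero
  field_simp

theorem tendsto_fourierIntegral_translate (h : ℝ → ℂ) (φ : TestSpace) :
    Tendsto (fun x => fourierIntegral h (translate x φ)) (cocompact ℝ) (𝓝 0) := by
  have := (tendsto_integral_mul_exp fun κ => h κ * dualHat φ κ).const_mul (2 * Real.pi : ℂ)⁻¹
  rw [mul_zero] at this
  refine this.congr fun x => ?_
  rw [fourierIntegral_eq]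
  congr 2
  funext κ
  rw [dualHat_translate]
  ring

/-- Fubini for `h(κ) φ(x) exp(-iκx)`, whose modulus is a product of integrable functions. -/
theorem fourierIntegral_of_integrable {h : ℝ → ℂ} (hh : Integrable h) (φ : TestSpace) :
    Integrable (fun x : ℝ =>
      ((2 * Real.pi : ℂ)⁻¹ * ∫ κ : ℝ, h κ * Complex.exp (-(Complex.I * κ * x))) *
        (φ : 𝓢(ℝ, ℂ)) x) ∧
    fourierIntegral h φ = ∫ x : ℝ,
      ((2 * Real.pi : ℂ)⁻¹ * ∫ κ : ℝ, h κ * Complex.exp (-(Complex.I * κ * x))) *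
        (φ : 𝓢(ℝ, ℂ)) x := by
  have h1 : Integrable (fun p : ℝ × ℝ => (h p.1 * (φ : 𝓢(ℝ, ℂ)) p.2) *
      Complex.exp (-(Complex.I * p.1 * p.2))) (volume.prod volume) := by
    refine (hh.mul_prod (φ : 𝓢(ℝ, ℂ)).integrable).mul_bdd (c := 1)
      (Continuous.aestronglyMeasurable (by fun_prop)) (Eventually.of_forall fun p => ?_)
    rw [show -(Complex.I * p.1 * p.2) = ((-(p.1 * p.2) : ℝ) : ℂ) * Complex.I by push_cast; ring,
      Complex.norm_exp_ofReal_mul_I]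
  have h2 : ∀ x : ℝ, ∫ κ : ℝ, (h κ * (φ : 𝓢(ℝ, ℂ)) x) * Complex.exp (-(Complex.I * κ * x)) =
      (∫ κ : ℝ, h κ * Complex.exp (-(Complex.I * κ * x))) * (φ : 𝓢(ℝ, ℂ)) x := fun x => by
    rw [← integral_mul_const]
    congr 1
    funext κ
    ring
  have h3 := h1.integral_prod_right
  simp only [h2] at h3
  refine ⟨by simpa only [mul_assoc] using h3.const_mul (2 * Real.pi : ℂ)⁻¹, ?_⟩
  have h4 := integral_integral_swap
    (f := fun κ x : ℝ => (h κ * (φ : 𝓢(ℝ, ℂ)) x) * Complex.exp (-(Complex.I * κ * x))) h1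
  simp only [h2] at h4
  simp only [mul_assoc (2 * Real.pi : ℂ)⁻¹]
  rw [integral_const_mul, ← h4, fourierIntegral]
  congr 2
  funext κ
  rw [fourierHat, ← integral_const_mul]
  congr 1
  funext x
  rw [show Complex.I * ((-κ : ℝ) : ℂ) * x = -(Complex.I * κ * x) by push_cast; ring, ← mul_assoc]

/-! ### The Mittag-Leffler function -/

theorem continuous_mittagLeffler {a : ℝ} (ha : 1 ≤ a) (b : ℝ) :
    Continuous (mittagLeffler a b) := by
  rw [continuous_iff_continuousAt]
  intro z
  have h : ContinuousOn (mittagLeffler a b) (Metric.ball 0 (‖z‖ + 1)) := by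
    refine continuousOn_tsum (fun n => ?_)
      (summable_pow_div_abs_Gamma ha b (‖z‖ + 1) (by positivity)) (fun n w hw => ?_)
    · fun_prop
    · rw [norm_div, norm_pow, Complex.norm_real, Real.norm_eq_abs]
      gcongr
      exact (mem_ball_zero_iff.1 hw).le
  exact h.continuousAt (Metric.isOpen_ball.mem_nhds (by simp))

theorem continuous_mittagLeffler_comp {a : ℝ} (ha : 1 ≤ a) (b : ℝ) {L : ℝ → ℂ}
    (hL : Continuous L) :
    Continuous fun p : ℝ × ℝ => mittagLeffler a b (((p.2 ^ a : ℝ) : ℂ) * L p.1) := by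
  have h1 : Continuous fun y : ℝ => y ^ a := Real.continuous_rpow_const (by linarith)
  refine (continuous_mittagLeffler ha b).comp ?_
  exact (Complex.continuous_ofReal.comp (h1.comp continuous_snd)).mul (hL.comp continuous_fst)

/-- The coefficients of the expansion of a tested solution in powers of `y`. -/
def moment (L h : ℝ → ℂ) (φ : TestSpace) (n : ℕ) : ℂ :=
  fourierIntegral (fun κ => L κ ^ n * h κ) φ

theorem exists_norm_le_on_dualHat {L : ℝ → ℂ} (hL : Continuous L) (φ : TestSpace) :
    ∃ M : ℝ, 0 ≤ M ∧ ∀ κ, dualHat φ κ ≠ 0 → ‖L κ‖ ≤ M := by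
  obtain ⟨R, hR, h⟩ := exists_dualHat_eq_zero φ
  obtain ⟨M, hM⟩ := isCompact_Icc.exists_bound_of_continuousOn (s := Set.Icc (-R) R)
    hL.continuousOn
  refine ⟨M, (norm_nonneg _).trans (hM 0 ⟨by linarith, hR.le⟩), fun κ hκ => hM κ ?_⟩
  by_contra h'
  exact hκ (h κ h')

theorem norm_fourierIntegral_le (h : ℝ → ℂ) (φ : TestSpace) :
    ‖fourierIntegral h φ‖ ≤ (2 * Real.pi)⁻¹ * ∫ κ : ℝ, ‖h κ * dualHat φ κ‖ := by
  rw [fourierIntegral_eq, norm_mul]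
  have : ‖(2 * Real.pi : ℂ)⁻¹‖ = (2 * Real.pi)⁻¹ := by
    rw [norm_inv, norm_mul, Complex.norm_real, Real.norm_of_nonneg Real.pi_pos.le]
    simp
  rw [this]
  gcongr
  exact norm_integral_le_integral_norm _

theorem norm_pow_mul_dualHat_le {L h : ℝ → ℂ} {φ : TestSpace} {M : ℝ}
    (hM : ∀ κ, dualHat φ κ ≠ 0 → ‖L κ‖ ≤ M) (n : ℕ) (κ : ℝ) :
    ‖L κ ^ n * h κ * dualHat φ κ‖ ≤ M ^ n * ‖h κ * dualHat φ κ‖ := by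
  by_cases h0 : dualHat φ κ = 0
  · simp [h0]
  · rw [mul_assoc, norm_mul, norm_pow]
    gcongr
    exact hM κ h0

theorem geomBounded_moment {L h : ℝ → ℂ} (hL : Continuous L) (hh : LocallyIntegrable h)
    (φ : TestSpace) : GeomBounded (moment L h φ) := by
  obtain ⟨M, hM0, hM⟩ := exists_norm_le_on_dualHat hL φ
  have hi := integrable_mul_dualHat hh φ
  refine ⟨(2 * Real.pi)⁻¹ * ∫ κ : ℝ, ‖h κ * dualHat φ κ‖, M, by positivity, hM0, fun n => ?_⟩
  refine (norm_fourierIntegral_le _ φ).trans ?_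
  rw [mul_assoc, ← integral_mul_const]
  gcongr
  · exact (integrable_mul_dualHat (locallyIntegrable_continuous_mul (hL.pow n) hh) φ).norm
  · exact hi.norm.mul_const _
  · intro κ
    simp only
    rw [mul_comm (‖h κ * dualHat φ κ‖)]
    exact norm_pow_mul_dualHat_le hM n κ

theorem moment_shift (L h : ℝ → ℂ) (φ : TestSpace) :
    (fun n => moment L h φ (n + 1)) = moment L (fun κ => L κ * h κ) φ := by
  funext n
  simp only [moment]
  congr 1
  funext κ
  ring

theorem moment_zero (L h : ℝ → ℂ) (φ : TestSpace) : moment L h φ 0 = fourierIntegral h φ := by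
  simp [moment]

/-- The building blocks `y^{b-1} E_{μ,b}(y^μ L(κ)) h(κ)` of the solution on the Fourier side. -/
def mlKernel (μ b : ℝ) (L h : ℝ → ℂ) (y κ : ℝ) : ℂ :=
  ((y ^ (b - 1) : ℝ) : ℂ) * (mittagLeffler μ b (((y ^ μ : ℝ) : ℂ) * L κ) * h κ)

theorem locallyIntegrable_mittagLeffler_mul {μ : ℝ} (hμ : 1 ≤ μ) (b : ℝ) {L h : ℝ → ℂ}
    (hL : Continuous L) (hh : LocallyIntegrable h) (y : ℝ) :
    LocallyIntegrable fun κ => mittagLeffler μ b (((y ^ μ : ℝ) : ℂ) * L κ) * h κ :=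
  locallyIntegrable_continuous_mul
    ((continuous_mittagLeffler hμ b).comp (continuous_const.mul hL)) hh

theorem locallyIntegrable_mlKernel {μ : ℝ} (hμ : 1 ≤ μ) (b : ℝ) {L h : ℝ → ℂ}
    (hL : Continuous L) (hh : LocallyIntegrable h) (y : ℝ) :
    LocallyIntegrable (mlKernel μ b L h y) :=
  locallyIntegrable_continuous_mul continuous_const
    (locallyIntegrable_mittagLeffler_mul hμ b hL hh y)

/-- The Mittag-Leffler series may be integrated term by term: with `‖L‖ ≤ M` where `φ̂(-κ) ≠ 0`, the
`L¹` norms are dominated by a multiple of `(M y^μ)ⁿ/|Γ(μn+b)|`. -/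
theorem fourierIntegral_mlKernel {μ : ℝ} (hμ : 1 ≤ μ) (b : ℝ) {L h : ℝ → ℂ}
    (hL : Continuous L) (hh : LocallyIntegrable h) {y : ℝ} (hy : 0 < y) (φ : TestSpace) :
    fourierIntegral (mlKernel μ b L h y) φ = powerSeries μ b (moment L h φ) y := by
  obtain ⟨M, hM0, hM⟩ := exists_norm_le_on_dualHat hL φ
  have hi := integrable_mul_dualHat hh φ
  set a : ℕ → ℂ := fun n => ((y ^ (μ * n + b - 1) / Real.Gamma (μ * n + b) : ℝ) : ℂ) with ha
  have han : ∀ n, a n = ((y ^ (b - 1) : ℝ) : ℂ) * ((y ^ μ : ℝ) : ℂ) ^ n /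
      (Real.Gamma (μ * n + b) : ℂ) := fun n => by
    rw [ha]
    simp only
    rw [rpow_mul_nat_add hy]
    push_cast
    ring
  set F : ℕ → ℝ → ℂ := fun n κ => a n * (L κ ^ n * h κ * dualHat φ κ) with hF
  have hFi : ∀ n, Integrable (F n) := fun n =>
    (integrable_mul_dualHat (locallyIntegrable_continuous_mul (hL.pow n) hh) φ).const_mul _
  have hs : Summable fun n => ∫ κ, ‖F n κ‖ := by
    refine Summable.of_nonneg_of_le (fun n => by positivity) (fun n => ?_)
      ((summable_pow_div_abs_Gamma hμ b (M * y ^ μ) (by positivity)).mul_left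
        ((∫ κ : ℝ, ‖h κ * dualHat φ κ‖) * y ^ (b - 1)))
    have h1 : ∫ κ, ‖F n κ‖ ≤ ∫ κ, ‖a n‖ * (M ^ n * ‖h κ * dualHat φ κ‖) := by
      refine integral_mono (hFi n).norm ((hi.norm.const_mul _).const_mul _) fun κ => ?_
      simp only [hF]
      rw [norm_mul]
      gcongr
      exact norm_pow_mul_dualHat_le hM n κ
    refine h1.trans_eq ?_
    have h2 : ‖a n‖ = y ^ (b - 1) * (y ^ μ) ^ n / |Real.Gamma (μ * n + b)| := by
      rw [ha]
      simp only
      rw [Complex.norm_real, Real.norm_eq_abs, abs_div,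
        abs_of_nonneg (Real.rpow_nonneg hy.le _), rpow_mul_nat_add hy]
    rw [integral_const_mul, integral_const_mul, h2, mul_pow]
    ring
  have key := (hasSum_integral_of_summable_integral_norm hFi hs).tsum_eq
  rw [fourierIntegral_eq]
  have e1 : ∀ κ, mlKernel μ b L h y κ * dualHat φ κ = ∑' n, F n κ := fun κ => by
    simp only [mlKernel, mittagLeffler, hF]
    rw [mul_assoc, mul_assoc, ← tsum_mul_right, ← tsum_mul_left]
    congr 1
    funext n
    rw [han, mul_pow]
    ring
  simp only [e1]
  rw [← key, ← tsum_mul_left, powerSeries]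
  congr 1
  funext n
  simp only [hF]
  rw [integral_const_mul, moment, fourierIntegral_eq]
  ring

/-- The Mittag-Leffler factor is continuous up to `y = 0`, hence bounded on the compact rectangle.
What remains is a product of `h(κ)` and `y^{b-1}`, integrable at 0 because `b > 0`. -/
theorem integrableOn_mlKernel {μ b : ℝ} (hμ : 1 ≤ μ) (hb : 0 < b) {L h : ℝ → ℂ}
    (hL : Continuous L) (hh : LocallyIntegrable h) (R Y : ℝ) :
    IntegrableOn (fun p : ℝ × ℝ => mlKernel μ b L h p.2 p.1)
      (Set.Icc (-R) R ×ˢ Set.Ioc 0 Y) := by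
  rcases le_or_gt Y 0 with hY | hY
  · simp [Set.Ioc_eq_empty_of_le hY]
  have h1 : Integrable h (volume.restrict (Set.Icc (-R) R)) :=
    hh.integrableOn_isCompact isCompact_Icc
  have h2 : Integrable (fun y : ℝ => ((y ^ (b - 1) : ℝ) : ℂ)) (volume.restrict (Set.Ioc 0 Y)) :=
    Integrable.ofReal ((intervalIntegrable_iff_integrableOn_Ioc_of_le hY.le).1
      (intervalIntegral.intervalIntegrable_rpow' (by linarith)))
  have h3 := h1.mul_prod h2
  rw [Measure.prod_restrict, ← Measure.volume_eq_prod] at h3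
  have hc := continuous_mittagLeffler_comp hμ b hL
  obtain ⟨K, hK⟩ := (isCompact_Icc.prod isCompact_Icc).exists_bound_of_continuousOn
    (s := Set.Icc (-R) R ×ˢ Set.Icc 0 Y) hc.continuousOn
  refine (h3.bdd_mul (c := K) hc.aestronglyMeasurable ?_).congr (Eventually.of_forall fun p => ?_)
  · refine (ae_restrict_mem (measurableSet_Icc.prod measurableSet_Ioc)).mono fun p hp => ?_
    exact hK p ⟨hp.1, hp.2.1.le, hp.2.2⟩
  · simp only [mlKernel]
    ring

/-! ### Hilfer derivatives -/

theorem RLConverges.add {γ : ℝ} {u w : ℝ → ℂ} {y : ℝ} (hu : RLConverges γ u y)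
    (hw : RLConverges γ w y) : RLConverges γ (fun t => u t + w t) y := by
  rcases hu with hu | hu
  · exact Or.inl hu
  rcases hw with hw | hw
  · exact Or.inl hw
  right
  simpa only [mul_add] using hu.add hw

theorem rlInt_add {γ : ℝ} {u w : ℝ → ℂ} {y : ℝ} (hu : RLConverges γ u y)
    (hw : RLConverges γ w y) :
    rlInt γ (fun t => u t + w t) y = rlInt γ u y + rlInt γ w y := by
  unfold rlInt
  split_ifs with h
  · rfl
  · simp only [mul_add]
    rw [intervalIntegral.integral_add (hu.resolve_left h) (hw.resolve_left h), mul_add]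

/-- On `y > 0`, `v` is the Hilfer derivative `I^{γ₁} (d/dy)² I^{γ₀} u`, and `f`, `g` are the initial
values of `I^{γ₀} u` and of its derivative. -/
def HasHilfer (γ₀ γ₁ : ℝ) (u v : ℝ → ℂ) (f g : ℂ) : Prop :=
  ∃ p p' p'' : ℝ → ℂ,
    (∀ y, 0 < y → RLConverges γ₀ u y ∧ rlInt γ₀ u y = p y ∧ HasDerivAt p (p' y) y ∧
      HasDerivAt p' (p'' y) y ∧ RLConverges γ₁ p'' y ∧ rlInt γ₁ p'' y = v y) ∧
    Tendsto p (𝓝[>] 0) (𝓝 f) ∧ Tendsto p' (𝓝[>] 0) (𝓝 g)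

theorem HasHilfer.add {γ₀ γ₁ : ℝ} {u₁ v₁ u₂ v₂ : ℝ → ℂ} {f₁ g₁ f₂ g₂ : ℂ}
    (h₁ : HasHilfer γ₀ γ₁ u₁ v₁ f₁ g₁) (h₂ : HasHilfer γ₀ γ₁ u₂ v₂ f₂ g₂) :
    HasHilfer γ₀ γ₁ (fun t => u₁ t + u₂ t) (fun t => v₁ t + v₂ t) (f₁ + f₂) (g₁ + g₂) := by
  obtain ⟨p, p', p'', h, hf, hg⟩ := h₁
  obtain ⟨r, r', r'', k, kf, kg⟩ := h₂
  refine ⟨fun t => p t + r t, fun t => p' t + r' t, fun t => p'' t + r'' t, fun y hy => ?_,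
    hf.add kf, hg.add kg⟩
  obtain ⟨a1, a2, a3, a4, a5, a6⟩ := h y hy
  obtain ⟨b1, b2, b3, b4, b5, b6⟩ := k y hy
  exact ⟨a1.add b1, by rw [rlInt_add a1 b1, a2, b2], a3.add b3, a4.add b4, a5.add b5,
    by rw [rlInt_add a5 b5, a6, b6]⟩

theorem HasHilfer.congr {γ₀ γ₁ : ℝ} {u v w x : ℝ → ℂ} {f g : ℂ}
    (h : HasHilfer γ₀ γ₁ u v f g) (hw : ∀ y, 0 < y → u y = w y) (hx : ∀ y, 0 < y → v y = x y) :
    HasHilfer γ₀ γ₁ w x f g := by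
  obtain ⟨p, p', p'', h, hf, hg⟩ := h
  refine ⟨p, p', p'', fun y hy => ?_, hf, hg⟩
  obtain ⟨a1, a2, a3, a4, a5, a6⟩ := h y hy
  exact ⟨(rlConverges_congr hy hw).1 a1, by rw [← rlInt_congr hy fun t ht _ => hw t ht, a2],
    a3, a4, a5, by rw [a6, hx y hy]⟩

theorem hasDerivAt_rlInt {γ₀ : ℝ} {u p p' : ℝ → ℂ}
    (h : ∀ y, 0 < y → rlInt γ₀ u y = p y ∧ HasDerivAt p (p' y) y) :
    ∀ y, 0 < y → HasDerivAt (rlInt γ₀ u) (p' y) y := by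
  intro y hy
  refine (h y hy).2.congr_of_eventuallyEq ?_
  filter_upwards [lt_mem_nhds hy] with t ht using (h t ht).1

theorem HasHilfer.spec {μ ν : ℝ} {u v : ℝ → ℂ} {f g : ℂ}
    (h : HasHilfer ((1 - ν) * (2 - μ)) (ν * (2 - μ)) u v f g) :
    HilferDifferentiable 2 μ ν u ∧ (∀ y, 0 < y → hilferDeriv 2 μ ν u y = v y) ∧
      Tendsto (rlInt ((1 - ν) * (2 - μ)) u) (𝓝[>] 0) (𝓝 f) ∧
      Tendsto (deriv (rlInt ((1 - ν) * (2 - μ)) u)) (𝓝[>] 0) (𝓝 g) := by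
  obtain ⟨p, p', p'', h, hf, hg⟩ := h
  set γ₀ := (1 - ν) * (2 - μ)
  have d1 : ∀ y, 0 < y → HasDerivAt (rlInt γ₀ u) (p' y) y :=
    hasDerivAt_rlInt fun y hy => ⟨(h y hy).2.1, (h y hy).2.2.1⟩
  have d2 : ∀ y, 0 < y → HasDerivAt (deriv (rlInt γ₀ u)) (p'' y) y := by
    intro y hy
    refine (h y hy).2.2.2.1.congr_of_eventuallyEq ?_
    filter_upwards [lt_mem_nhds hy] with t ht using (d1 t ht).deriv
  have d3 : ∀ y, 0 < y → p'' y = iteratedDeriv 2 (rlInt γ₀ u) y := by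
    intro y hy
    rw [iteratedDeriv_succ, iteratedDeriv_one, (d2 y hy).deriv]
  refine ⟨⟨?_, ?_, ?_⟩, ?_, ?_, ?_⟩
  · intro y hy
    simpa using (h y hy).1
  · intro j hj y hy
    simp only [Nat.cast_ofNat]
    interval_cases j
    · simpa using (d1 y hy).differentiableAt
    · simpa using (d2 y hy).differentiableAt
  · intro y hy
    simp only [Nat.cast_ofNat]
    exact (rlConverges_congr hy d3).1 (h y hy).2.2.2.2.1
  · intro y hy
    simp only [hilferDeriv, Nat.cast_ofNat]
    rw [← rlInt_congr hy fun t ht _ => d3 t ht]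
    exact (h y hy).2.2.2.2.2
  · refine hf.congr' ?_
    filter_upwards [self_mem_nhdsWithin] with y hy using (h y hy).2.1.symm
  · refine hg.congr' ?_
    filter_upwards [self_mem_nhdsWithin] with y hy using (d1 y hy).deriv.symm

/-- The block carrying `f`. The parameter `b` runs through `1-γ₀`, `1`, `0`; there the leading term
has vanished, so the series restarts, with shifted coefficients, at `μ`, and continues through `μ-1`
to `μ-1+γ₁ = 1-γ₀`. -/
theorem hasHilfer_powerSeries_one_sub {μ γ₀ γ₁ : ℝ} (hμ : 1 < μ) (h₀ : 0 ≤ γ₀)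
    (h₁ : 0 ≤ γ₁) (h : γ₀ + γ₁ = 2 - μ) {c : ℕ → ℂ} (hc : GeomBounded c) :
    HasHilfer γ₀ γ₁ (powerSeries μ (1 - γ₀) c) (powerSeries μ (1 - γ₀) fun n => c (n + 1))
      (c 0) 0 := by
  -- The leading term carries `1/Γ(0) = 0`. Rewriting before the second differentiation keeps `b`
  -- positive, as the fractional integral requires.
  have e0 : ∀ y, 0 < y → powerSeries μ 0 c y = powerSeries μ μ (fun n => c (n + 1)) y := by
    intro y hy
    rw [powerSeries_eq_add_shift hμ.le hc hy]
    simp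
  refine ⟨powerSeries μ 1 c, powerSeries μ 0 c, powerSeries μ (μ - 1) fun n => c (n + 1),
    fun y hy => ⟨rlConverges_powerSeries hμ.le hc (by linarith) h₀ hy, ?_, ?_, ?_,
      rlConverges_powerSeries hμ.le hc.shift (by linarith) h₁ hy, ?_⟩,
    tendsto_powerSeries_one hμ.le hc, ?_⟩
  · rw [rlInt_powerSeries hμ.le hc (by linarith) h₀ hy, sub_add_cancel]
  · simpa using hasDerivAt_powerSeries (b := 1) hμ.le hc hy
  · refine (hasDerivAt_powerSeries (b := μ) hμ.le hc.shift hy).congr_of_eventuallyEq ?_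
    filter_upwards [lt_mem_nhds hy] with t ht using e0 t ht
  · rw [rlInt_powerSeries hμ.le hc.shift (by linarith) h₁ hy]
    congr 1
    linarith
  · refine (tendsto_powerSeries_zero hμ.le hc.shift hμ).congr' ?_
    filter_upwards [self_mem_nhdsWithin] with y hy using (e0 y hy).symm

/-- The block carrying `g`: the leading term is now linear after `I^{γ₀}`, so it survives one
differentiation and dies at the second. -/
theorem hasHilfer_powerSeries_two_sub {μ γ₀ γ₁ : ℝ} (hμ : 1 < μ) (h₀ : 0 ≤ γ₀)
    (h₁ : 0 ≤ γ₁) (h : γ₀ + γ₁ = 2 - μ) {c : ℕ → ℂ} (hc : GeomBounded c) :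
    HasHilfer γ₀ γ₁ (powerSeries μ (2 - γ₀) c) (powerSeries μ (2 - γ₀) fun n => c (n + 1))
      0 (c 0) := by
  have e0 : ∀ y, 0 < y → powerSeries μ 0 c y = powerSeries μ μ (fun n => c (n + 1)) y := by
    intro y hy
    rw [powerSeries_eq_add_shift hμ.le hc hy]
    simp
  refine ⟨powerSeries μ 2 c, powerSeries μ 1 c, powerSeries μ μ fun n => c (n + 1),
    fun y hy => ⟨rlConverges_powerSeries hμ.le hc (by linarith) h₀ hy, ?_, ?_, ?_,
      rlConverges_powerSeries hμ.le hc.shift (by linarith) h₁ hy, ?_⟩,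
    tendsto_powerSeries_zero hμ.le hc (by norm_num), tendsto_powerSeries_one hμ.le hc⟩
  · rw [rlInt_powerSeries hμ.le hc (by linarith) h₀ hy, sub_add_cancel]
  · have := hasDerivAt_powerSeries (b := 2) hμ.le hc hy
    norm_num at this
    exact this
  · have := hasDerivAt_powerSeries (b := 1) hμ.le hc hy
    rw [sub_self, e0 y hy] at this
    exact this
  · rw [rlInt_powerSeries hμ.le hc.shift (by linarith) h₁ hy]
    congr 1
    linarith

/-- The block for the source. For `b + γ₀ > 2` both initial values vanish and the second derivative
is still integrable at 0, so no term is lost. -/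
theorem hasHilfer_powerSeries {μ γ₀ γ₁ : ℝ} (hμ : 1 < μ) (h₀ : 0 ≤ γ₀)
    (h₁ : 0 ≤ γ₁) (h : γ₀ + γ₁ = 2 - μ) {c : ℕ → ℂ} (hc : GeomBounded c)
    {b : ℝ} (hb : 2 - γ₀ < b) :
    HasHilfer γ₀ γ₁ (powerSeries μ b c) (powerSeries μ (b - μ) c) 0 0 := by
  refine ⟨powerSeries μ (b + γ₀) c, powerSeries μ (b + γ₀ - 1) c, powerSeries μ (b + γ₀ - 1 - 1) c,
    fun y hy => ⟨rlConverges_powerSeries hμ.le hc (by linarith) h₀ hy, ?_, ?_, ?_,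
      rlConverges_powerSeries hμ.le hc (by linarith) h₁ hy, ?_⟩,
    tendsto_powerSeries_zero hμ.le hc (by linarith),
    tendsto_powerSeries_zero hμ.le hc (by linarith)⟩
  · rw [rlInt_powerSeries hμ.le hc (by linarith) h₀ hy]
  · exact hasDerivAt_powerSeries hμ.le hc hy
  · exact hasDerivAt_powerSeries hμ.le hc hy
  · rw [rlInt_powerSeries hμ.le hc (by linarith) h₁ hy]
    congr 1
    linarith

/-! ### Fractional integrals of families of Fourier transforms -/

/-- `U(κ, y)` is integrable over `[-R, R] × (0, Y]` for all `R`, `Y`. -/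
def IsLocIntegrableFamily (U : ℝ → ℝ → ℂ) : Prop :=
  ∀ R Y : ℝ, IntegrableOn (fun p : ℝ × ℝ => U p.1 p.2) (Set.Icc (-R) R ×ˢ Set.Ioc 0 Y)

section Family

variable {U : ℝ → ℝ → ℂ} {χ : ℝ → ℂ} {R C y : ℝ}

theorem IsLocIntegrableFamily.integrable_prod (hU : IsLocIntegrableFamily U) (R y : ℝ) :
    Integrable (fun p : ℝ × ℝ => U p.1 p.2)
      ((volume.restrict (Set.Icc (-R) R)).prod (volume.restrict (Set.Ioc 0 y))) := by
  have := hU R y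
  rwa [IntegrableOn, Measure.volume_eq_prod, ← Measure.prod_restrict] at this

theorem IsLocIntegrableFamily.integrable_mul (hU : IsLocIntegrableFamily U) (hχ : Continuous χ)
    (hC : ∀ κ, ‖χ κ‖ ≤ C) :
    Integrable (fun p : ℝ × ℝ => U p.1 p.2 * χ p.1)
      ((volume.restrict (Set.Icc (-R) R)).prod (volume.restrict (Set.Ioc 0 y))) :=
  (hU.integrable_prod R y).mul_bdd (c := C) (by fun_prop) (Eventually.of_forall fun p => hC p.1)

theorem setIntegral_Icc_eq_integral (w : ℝ → ℂ) (hR : ∀ κ, κ ∉ Set.Icc (-R) R → χ κ = 0) :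
    ∫ κ in Set.Icc (-R) R, w κ * χ κ = ∫ κ, w κ * χ κ :=
  setIntegral_eq_integral_of_forall_compl_eq_zero fun κ hκ => by rw [hR κ hκ, mul_zero]

theorem IsLocIntegrableFamily.integrableOn (hU : IsLocIntegrableFamily U) (hχ : Continuous χ)
    (hC : ∀ κ, ‖χ κ‖ ≤ C) (hR : ∀ κ, κ ∉ Set.Icc (-R) R → χ κ = 0) :
    IntegrableOn (fun t => ∫ κ, U κ t * χ κ) (Set.Ioc 0 y) := by
  have := (hU.integrable_mul (R := R) (y := y) hχ hC).integral_prod_right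
  simp only [setIntegral_Icc_eq_integral _ hR] at this
  exact this

theorem IsLocIntegrableFamily.integral_norm_le (hU : IsLocIntegrableFamily U) (hχ : Continuous χ)
    (hC : ∀ κ, ‖χ κ‖ ≤ C) (hR : ∀ κ, κ ∉ Set.Icc (-R) R → χ κ = 0) :
    ∫ t in Set.Ioc 0 y, ‖∫ κ, U κ t * χ κ‖ ≤
      C * ∫ t in Set.Ioc 0 y, ∫ κ in Set.Icc (-R) R, ‖U κ t‖ := by
  have h1 := (hU.integrable_prod R y).norm.integral_prod_right
  rw [← integral_const_mul]
  refine integral_mono_ae (hU.integrableOn hχ hC hR).norm (h1.const_mul C) ?_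
  filter_upwards [(hU.integrable_prod R y).prod_left_ae] with t ht
  rw [← setIntegral_Icc_eq_integral _ hR, ← integral_const_mul]
  refine norm_integral_le_of_norm_le (ht.norm.const_mul C) (Eventually.of_forall fun κ => ?_)
  rw [norm_mul, mul_comm]
  gcongr
  exact hC κ

theorem IsLocIntegrableFamily.integrable_kernel (hU : IsLocIntegrableFamily U) {a : ℝ}
    (ha : 1 ≤ a) :
    Integrable (fun p : ℝ × ℝ => (((y - p.2) ^ (a - 1) : ℝ) : ℂ) * U p.1 p.2)
      ((volume.restrict (Set.Icc (-R) R)).prod (volume.restrict (Set.Ioc 0 y))) := by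
  refine (hU.integrable_prod R y).bdd_mul (c := y ^ (a - 1)) ?_ ?_
  · refine (Complex.measurable_ofReal.comp ?_).aestronglyMeasurable
    fun_prop
  · rw [Measure.prod_restrict]
    refine (ae_restrict_mem (measurableSet_Icc.prod measurableSet_Ioc)).mono fun p hp => ?_
    have h2 : 0 ≤ y - p.2 := sub_nonneg.2 hp.2.2
    rw [Complex.norm_real, Real.norm_of_nonneg (Real.rpow_nonneg h2 _)]
    exact Real.rpow_le_rpow h2 (by linarith [hp.2.1]) (by linarith)

theorem IsLocIntegrableFamily.locallyIntegrable_rlInt (hU : IsLocIntegrableFamily U) {a : ℝ}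
    (ha : 1 ≤ a) (hy : 0 < y) : LocallyIntegrable fun κ => rlInt a (U κ) y := by
  refine (locallyIntegrable_iff).2 fun K hK => ?_
  obtain ⟨R, hR⟩ := hK.isBounded.subset_closedBall 0
  rw [Real.closedBall_eq_Icc, zero_sub, zero_add] at hR
  refine IntegrableOn.mono_set ?_ hR
  have := (hU.integrable_kernel (R := R) (y := y) ha).integral_prod_left
  simp only [rlInt, if_neg (by linarith : ¬ a = 0), intervalIntegral.integral_of_le hy.le]
  exact this.const_mul _

theorem IsLocIntegrableFamily.rlInt_integral (hU : IsLocIntegrableFamily U) (hχ : Continuous χ)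
    (hC : ∀ κ, ‖χ κ‖ ≤ C) (hR : ∀ κ, κ ∉ Set.Icc (-R) R → χ κ = 0) {a : ℝ} (ha : 1 ≤ a)
    (hy : 0 < y) :
    rlInt a (fun t => ∫ κ, U κ t * χ κ) y = ∫ κ, rlInt a (U κ) y * χ κ := by
  have h1 : Integrable (fun p : ℝ × ℝ => (((y - p.2) ^ (a - 1) : ℝ) : ℂ) * U p.1 p.2 * χ p.1)
      ((volume.restrict (Set.Icc (-R) R)).prod (volume.restrict (Set.Ioc 0 y))) :=
    (hU.integrable_kernel ha).mul_bdd (c := C) (by fun_prop) (Eventually.of_forall fun p => hC p.1)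
  have h2 := integral_integral_swap
    (f := fun κ t : ℝ => (((y - t) ^ (a - 1) : ℝ) : ℂ) * U κ t * χ κ) h1
  rw [← setIntegral_Icc_eq_integral _ hR]
  simp only [rlInt, if_neg (by linarith : ¬ a = 0), intervalIntegral.integral_of_le hy.le]
  simp only [mul_assoc _ _ (χ _)]
  rw [integral_const_mul]
  congr 1
  simp only [← integral_mul_const]
  rw [h2]
  congr 1
  funext t
  simp only [mul_assoc]
  rw [integral_const_mul, setIntegral_Icc_eq_integral _ hR]

end Family

/-- The weight includes `Lⁿ` and `(2π)⁻¹`. What matters is that `C`, `M` and `R` do not depend on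
`n`, as the iteration of the Volterra equation needs. -/
theorem exists_norm_mul_dualHat_le {L : ℝ → ℂ} (hL : Continuous L) (φ : TestSpace) :
    ∃ C M R : ℝ, 0 ≤ C ∧ 0 ≤ M ∧
      (∀ (n : ℕ) κ, ‖(2 * Real.pi : ℂ)⁻¹ * (L κ ^ n * dualHat φ κ)‖ ≤ C * M ^ n) ∧
      ∀ (n : ℕ) κ, κ ∉ Set.Icc (-R) R → (2 * Real.pi : ℂ)⁻¹ * (L κ ^ n * dualHat φ κ) = 0 := by
  obtain ⟨C, hC0, hC⟩ := exists_norm_dualHat_le φ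
  obtain ⟨M, hM0, hM⟩ := exists_norm_le_on_dualHat hL φ
  obtain ⟨R, -, hR⟩ := exists_dualHat_eq_zero φ
  refine ⟨‖(2 * Real.pi : ℂ)⁻¹‖ * C, M, R, by positivity, hM0, fun n κ => ?_, fun n κ hκ => ?_⟩
  · by_cases h0 : dualHat φ κ = 0
    · rw [h0, mul_zero, mul_zero, norm_zero]
      positivity
    · rw [norm_mul, norm_mul, norm_pow, mul_assoc, mul_comm C]
      gcongr
      · exact hM κ h0
      · exact hC κ
  · rw [hR κ hκ, mul_zero, mul_zero]

theorem fourierIntegral_pow_mul (L h : ℝ → ℂ) (n : ℕ) (φ : TestSpace) :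
    fourierIntegral (fun κ => L κ ^ n * h κ) φ =
      ∫ κ, h κ * ((2 * Real.pi : ℂ)⁻¹ * (L κ ^ n * dualHat φ κ)) := by
  rw [fourierIntegral_eq, ← integral_const_mul]
  congr 1
  funext κ
  ring

theorem continuous_pow_mul_dualHat {L : ℝ → ℂ} (hL : Continuous L) (n : ℕ) (φ : TestSpace) :
    Continuous fun κ => (2 * Real.pi : ℂ)⁻¹ * (L κ ^ n * dualHat φ κ) :=
  continuous_const.mul ((hL.pow n).mul (continuous_dualHat φ))

theorem IsLocIntegrableFamily.integrableOn_fourierIntegral {U : ℝ → ℝ → ℂ}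
    (hU : IsLocIntegrableFamily U) {L : ℝ → ℂ} (hL : Continuous L) (n : ℕ) (φ : TestSpace)
    (y : ℝ) :
    IntegrableOn (fun t => fourierIntegral (fun κ => L κ ^ n * U κ t) φ) (Set.Ioc 0 y) := by
  obtain ⟨C, M, R, -, -, hC, hR⟩ := exists_norm_mul_dualHat_le hL φ
  simp only [fourierIntegral_pow_mul]
  exact hU.integrableOn (continuous_pow_mul_dualHat hL n φ) (hC n) (hR n)

theorem IsLocIntegrableFamily.rlInt_fourierIntegral {U : ℝ → ℝ → ℂ}
    (hU : IsLocIntegrableFamily U) {L : ℝ → ℂ} (hL : Continuous L) (n : ℕ) (φ : TestSpace)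
    {a : ℝ} (ha : 1 ≤ a) {y : ℝ} (hy : 0 < y) :
    rlInt a (fun t => fourierIntegral (fun κ => L κ ^ n * U κ t) φ) y =
      fourierIntegral (fun κ => L κ ^ n * rlInt a (U κ) y) φ := by
  obtain ⟨C, M, R, -, -, hC, hR⟩ := exists_norm_mul_dualHat_le hL φ
  simp only [fourierIntegral_pow_mul]
  exact hU.rlInt_integral (continuous_pow_mul_dualHat hL n φ) (hC n) (hR n) ha hy

/-- The Volterra equation `I^a U = L I^{a+μ} U` has only the trivial solution. -/
theorem IsLocIntegrableFamily.rlInt_eq_zero {U : ℝ → ℝ → ℂ} (hU : IsLocIntegrableFamily U)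
    {L : ℝ → ℂ} (hL : Continuous L) {a μ : ℝ} (ha : 1 ≤ a) (hμ : 1 ≤ μ)
    (h : ∀ (φ : TestSpace) y, 0 < y →
      rlInt a (fun t => fourierIntegral (fun κ => U κ t) φ) y =
        rlInt (a + μ) (fun t => fourierIntegral (fun κ => L κ * U κ t) φ) y)
    (φ : TestSpace) {y : ℝ} (hy : 0 < y) :
    rlInt a (fun t => fourierIntegral (fun κ => U κ t) φ) y = 0 := by
  have haμ : 1 ≤ a + μ := by linarith
  -- The tested identity is first made pointwise in `κ`: since `L` is only continuous, `L φ̂` need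
  -- not come from a test function, so the hypothesis cannot be iterated directly.
  have hae : ∀ y, 0 < y →
      (fun κ => rlInt a (U κ) y) =ᵐ[volume] fun κ => L κ * rlInt (a + μ) (U κ) y := by
    intro y hy
    refine ae_eq_of_fourierIntegral_eq (hU.locallyIntegrable_rlInt ha hy)
      (locallyIntegrable_continuous_mul hL (hU.locallyIntegrable_rlInt haμ hy)) fun φ => ?_
    have e0 := hU.rlInt_fourierIntegral hL 0 φ ha hy
    have e1 := hU.rlInt_fourierIntegral hL 1 φ haμ hy
    simp only [pow_zero, one_mul] at e0
    simp only [pow_one] at e1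
    rw [← e0, ← e1, h φ y hy]
  set x : ℕ → ℝ → ℂ := fun n t => fourierIntegral (fun κ => L κ ^ n * U κ t) φ with hx
  have hxi : ∀ n y, IntegrableOn (x n) (Set.Ioc 0 y) := fun n y =>
    hU.integrableOn_fourierIntegral hL n φ y
  have hstep : ∀ n y, 0 < y → rlInt a (x n) y = rlInt (a + μ) (x (n + 1)) y := by
    intro n y hy
    rw [hx, hU.rlInt_fourierIntegral hL n φ ha hy, hU.rlInt_fourierIntegral hL (n + 1) φ haμ hy]
    refine fourierIntegral_congr_ae ((hae y hy).mono fun κ hκ => ?_) φ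
    simp only at hκ ⊢
    rw [hκ]
    ring
  have hiter : ∀ n : ℕ, ∀ y, 0 < y → rlInt a (x 0) y = rlInt (μ * n + a) (x n) y := by
    intro n
    induction n with
    | zero => intro y _; simp
    | succ n ih =>
      intro y hy
      rw [ih y hy]
      -- The semigroup law `I^{μn+a} = I^{μn} I^a` is stated for positive outer order, so `n = 0` is
      -- separate.
      rcases n.eq_zero_or_pos with h0 | h0
      · subst h0
        have := hstep 0 y hy
        simp only [Nat.cast_zero, mul_zero, zero_add, Nat.cast_one, mul_one] at this ⊢
        rw [this, add_comm]
      · have hpos : 1 ≤ μ * n := by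
          have : (1 : ℝ) ≤ n := by exact_mod_cast h0
          nlinarith
        rw [← rlInt_rlInt (by linarith) (by linarith) (by linarith) hy (hxi n y),
          rlInt_congr hy fun t ht _ => hstep n t ht,
          rlInt_rlInt (by linarith) (by linarith) (by linarith) hy (hxi (n + 1) y)]
        congr 1
        push_cast
        ring
  obtain ⟨C, M, R, hC0, hM0, hC, hR⟩ := exists_norm_mul_dualHat_le hL φ
  set B := ∫ t in Set.Ioc 0 y, ∫ κ in Set.Icc (-R) R, ‖U κ t‖
  have hB : 0 ≤ B := integral_nonneg fun t => integral_nonneg fun κ => norm_nonneg _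
  have hbound : ∀ n : ℕ, ‖rlInt a (x 0) y‖ ≤
      (y ^ (a - 1) * C * B) * ((M * y ^ μ) ^ n / |Real.Gamma (μ * n + a)|) := by
    intro n
    have hn : 0 ≤ μ * n := by positivity
    have hΓ := Real.Gamma_pos_of_pos (show 0 < μ * n + a by linarith)
    rw [hiter n y hy]
    refine (norm_rlInt_le (by linarith) hy (hxi n y)).trans ?_
    have h1 : ∫ t in Set.Ioc 0 y, ‖x n t‖ ≤ C * M ^ n * B := by
      simp only [hx, fourierIntegral_pow_mul]
      exact hU.integral_norm_le (continuous_pow_mul_dualHat hL n φ) (hC n) (hR n)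
    calc y ^ (μ * n + a - 1) / Real.Gamma (μ * n + a) * ∫ t in Set.Ioc 0 y, ‖x n t‖
        ≤ y ^ (μ * n + a - 1) / Real.Gamma (μ * n + a) * (C * M ^ n * B) := by gcongr
      _ = _ := by
        rw [rpow_mul_nat_add hy, abs_of_pos hΓ, mul_pow]
        ring
  have hlim := ((summable_pow_div_abs_Gamma hμ a (M * y ^ μ)
    (by positivity)).tendsto_atTop_zero).const_mul (y ^ (a - 1) * C * B)
  rw [mul_zero] at hlim
  have h0 : rlInt a (x 0) y = 0 := norm_le_zero_iff.1 (ge_of_tendsto' hlim hbound)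
  simpa only [hx, pow_zero, one_mul] using h0

/-! ### Uniqueness -/

theorem rlConverges_of_integrableOn {a : ℝ} (ha : 1 ≤ a) {u : ℝ → ℂ} {y : ℝ} (hy : 0 < y)
    (hu : IntegrableOn u (Set.Ioc 0 y)) : RLConverges a u y := by
  right
  rw [intervalIntegrable_iff_integrableOn_Ioc_of_le hy.le]
  refine hu.bdd_mul (c := y ^ (a - 1)) ?_ ?_
  · refine (Complex.measurable_ofReal.comp ?_).aestronglyMeasurable
    fun_prop
  · refine (ae_restrict_mem measurableSet_Ioc).mono fun t ht => ?_
    have h2 : 0 ≤ y - t := sub_nonneg.2 ht.2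
    rw [Complex.norm_real, Real.norm_of_nonneg (Real.rpow_nonneg h2 _)]
    exact Real.rpow_le_rpow h2 (by linarith [ht.1]) (by linarith)

theorem rlInt_sub {γ : ℝ} {u w : ℝ → ℂ} {y : ℝ} (hu : RLConverges γ u y)
    (hw : RLConverges γ w y) :
    rlInt γ (fun t => u t - w t) y = rlInt γ u y - rlInt γ w y := by
  unfold rlInt
  split_ifs with h
  · rfl
  · simp only [mul_sub]
    rw [intervalIntegral.integral_sub (hu.resolve_left h) (hw.resolve_left h), mul_sub]

theorem fourierIntegral_sub {h₁ h₂ : ℝ → ℂ} (hh₁ : LocallyIntegrable h₁)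
    (hh₂ : LocallyIntegrable h₂) (φ : TestSpace) :
    fourierIntegral (fun κ => h₁ κ - h₂ κ) φ = fourierIntegral h₁ φ - fourierIntegral h₂ φ := by
  simp only [fourierIntegral_eq, sub_mul]
  rw [integral_sub (integrable_mul_dualHat hh₁ φ) (integrable_mul_dualHat hh₂ φ), mul_sub]

/-- Differentiate both primitives; continuity gives equality at every point. -/
theorem eqOn_of_integral_eq {p r : ℝ → ℂ} (hp : ∀ y, 0 < y → IntegrableOn p (Set.Ioc 0 y))
    (hr : ∀ y, 0 < y → IntegrableOn r (Set.Ioc 0 y)) (hpc : ContinuousOn p (Set.Ioi 0))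
    (hrc : ContinuousOn r (Set.Ioi 0))
    (h : ∀ y, 0 < y → ∫ t in (0 : ℝ)..y, p t = ∫ t in (0 : ℝ)..y, r t) :
    Set.EqOn p r (Set.Ioi 0) := by
  have key : ∀ q : ℝ → ℂ, (∀ y, 0 < y → IntegrableOn q (Set.Ioc 0 y)) →
      ContinuousOn q (Set.Ioi 0) → ∀ y, 0 < y →
      HasDerivAt (fun y => ∫ t in (0 : ℝ)..y, q t) (q y) y := by
    intro q hq hqc y hy
    refine intervalIntegral.integral_hasDerivAt_right
      ((intervalIntegrable_iff_integrableOn_Ioc_of_le hy.le).2 (hq y hy)) ?_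
      (hqc.continuousAt (Ioi_mem_nhds hy))
    exact hqc.stronglyMeasurableAtFilter isOpen_Ioi y hy
  intro y hy
  refine (key p hp hpc y hy).unique ((key r hr hrc y hy).congr_of_eventuallyEq ?_)
  filter_upwards [Ioi_mem_nhds hy] with t ht using h t ht

theorem HilferDifferentiable.rlInt_eq {μ ν : ℝ} (hμ₁ : 1 < μ) (hμ₂ : μ ≤ 2) (hν₀ : 0 ≤ ν)
    (hν₁ : ν ≤ 1) {u v : ℝ → ℂ} (h : HilferDifferentiable 2 μ ν u)
    (hu : ∀ y, 0 < y → IntegrableOn u (Set.Ioc 0 y))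
    (hv : ∀ y, 0 < y → IntegrableOn v (Set.Ioc 0 y))
    (huv : ∀ y, 0 < y → hilferDeriv 2 μ ν u y = v y) {f g : ℂ}
    (hf : Tendsto (rlInt ((1 - ν) * (2 - μ)) u) (𝓝[>] 0) (𝓝 f))
    (hg : Tendsto (deriv (rlInt ((1 - ν) * (2 - μ)) u)) (𝓝[>] 0) (𝓝 g)) {y : ℝ} (hy : 0 < y) :
    IntegrableOn (rlInt ((1 - ν) * (2 - μ)) u) (Set.Ioc 0 y) ∧
      rlInt (1 + (1 - ν) * (2 - μ)) u y =
        f * y + g * (y ^ 2 / 2) + rlInt (3 - ν * (2 - μ)) v y := by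
  obtain ⟨-, h2, h3⟩ := h
  simp only [hilferDeriv, Nat.cast_ofNat, iteratedDeriv_succ, iteratedDeriv_zero] at h2 h3 huv
  refine rlInt_eq_of_hilfer (mul_nonneg (by linarith) (by linarith))
    (mul_nonneg hν₀ (by linarith)) (by nlinarith) hu (fun y hy => ?_) (fun y hy => ?_) h3 hv huv
    hf hg hy
  · simpa using h2 0 (by norm_num) y hy
  · simpa using h2 1 (by norm_num) y hy

/-- On the Fourier side, a solution satisfies `D_y^{μ,ν} N̂ = L N̂ + Φ̂`. -/
theorem IsSolution.exists_family {D : GenFun → GenFun → Prop} {μ ν k : ℝ} {f g : GenFun}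
    {Φ N : ℝ → GenFun} (hN : IsSolution D μ ν k f g Φ N) {σ : ℝ → ℂ} (hσ : Continuous σ)
    (hD : ∀ T S, D T S ↔ ∃ h, HasFourier T h ∧ HasFourier S fun κ => -σ κ * h κ) :
    ∃ U : ℝ → ℝ → ℂ, (∀ y, 0 < y → HasFourier (N y) fun κ => U κ y) ∧
      IsLocIntegrableFamily U ∧ ∀ φ y, 0 < y → hilferDeriv 2 μ ν (fun t => N t φ) y =
        fourierIntegral (fun κ => (σ κ - (k : ℂ) ^ 2) * U κ y) φ + Φ y φ := by
  obtain ⟨U, hU, hUi⟩ := hN.fourier_integrable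
  refine ⟨U, hU, hUi, fun φ y hy => ?_⟩
  obtain ⟨S, hS, he⟩ := hN.equation y hy
  obtain ⟨h, hT, hS⟩ := (hD _ _).1 hS
  have hae := hT.ae_eq (hU y hy)
  have e1 : S φ = fourierIntegral (fun κ => -σ κ * U κ y) φ := by
    rw [hS.2]
    exact fourierIntegral_congr_ae (hae.mono fun κ hκ => by simp only [hκ]) φ
  have hl := (hU y hy).1
  have e2 : fourierIntegral (fun κ => (σ κ - (k : ℂ) ^ 2) * U κ y) φ +
      fourierIntegral (fun κ => -σ κ * U κ y) φ =
      -(k : ℂ) ^ 2 * fourierIntegral (fun κ => U κ y) φ := by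
    rw [← fourierIntegral_add
      (locallyIntegrable_continuous_mul (c := fun κ => σ κ - (k : ℂ) ^ 2) (by fun_prop) hl)
      (locallyIntegrable_continuous_mul (c := fun κ => -σ κ) (by fun_prop) hl),
      ← fourierIntegral_const_mul]
    congr 1
    funext κ
    ring
  have e3 := he φ
  rw [e1, (hU y hy).2 φ] at e3
  linear_combination e3 - e2

/-- The Volterra argument identifies only integrals of the solutions in `y`. No continuity of `N` in
`y` is assumed, so equality at a given `y` is recovered from the equation itself, which is where
`hσ0` enters. -/
theorem IsSolution.unique {D : GenFun → GenFun → Prop} {μ ν k : ℝ} (hμ₁ : 1 < μ) (hμ₂ : μ ≤ 2)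
    (hν₀ : 0 ≤ ν) (hν₁ : ν ≤ 1) {f g : GenFun} {Φ : ℝ → GenFun}
    (hΦ : ∀ φ y, 0 < y → IntegrableOn (fun t => Φ t φ) (Set.Ioc 0 y))
    {σ : ℝ → ℂ} (hσ : Continuous σ) (hσ0 : ∀ᵐ κ, σ κ - (k : ℂ) ^ 2 ≠ 0)
    (hD : ∀ T S, D T S ↔ ∃ h, HasFourier T h ∧ HasFourier S fun κ => -σ κ * h κ)
    {N₁ N₂ : ℝ → GenFun} (h₁ : IsSolution D μ ν k f g Φ N₁) (h₂ : IsSolution D μ ν k f g Φ N₂)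
    {y : ℝ} (hy : 0 < y) : N₁ y = N₂ y := by
  obtain ⟨U₁, hU₁, hUi₁, he₁⟩ := h₁.exists_family hσ hD
  obtain ⟨U₂, hU₂, hUi₂, he₂⟩ := h₂.exists_family hσ hD
  set L : ℝ → ℂ := fun κ => σ κ - (k : ℂ) ^ 2 with hLdef
  have hL : Continuous L := hσ.sub continuous_const
  set γ₀ := (1 - ν) * (2 - μ) with hγ₀
  have hγ : 0 ≤ γ₀ := mul_nonneg (by linarith) (by linarith)
  have hγ₁ : ν * (2 - μ) < 1 := by nlinarith
  have hUi : IsLocIntegrableFamily fun κ t => U₁ κ t - U₂ κ t := fun R Y =>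
    (hUi₁ R Y).sub (hUi₂ R Y)
  have facts : ∀ {N : ℝ → GenFun} {U : ℝ → ℝ → ℂ}, IsSolution D μ ν k f g Φ N →
      (∀ y, 0 < y → HasFourier (N y) fun κ => U κ y) → IsLocIntegrableFamily U →
      (∀ φ y, 0 < y → hilferDeriv 2 μ ν (fun t => N t φ) y =
        fourierIntegral (fun κ => L κ * U κ y) φ + Φ y φ) → ∀ φ y, 0 < y →
      IntegrableOn (fun t => N t φ) (Set.Ioc 0 y) ∧
      IntegrableOn (fun t => fourierIntegral (fun κ => L κ * U κ t) φ + Φ t φ) (Set.Ioc 0 y) ∧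
      IntegrableOn (rlInt γ₀ fun t => N t φ) (Set.Ioc 0 y) ∧
      rlInt (1 + γ₀) (fun t => N t φ) y = f φ * y + g φ * (y ^ 2 / 2) + rlInt (3 - ν * (2 - μ))
        (fun t => fourierIntegral (fun κ => L κ * U κ t) φ + Φ t φ) y := by
    intro N U hN hU hUi he φ y hy
    have i1 : ∀ y, 0 < y → IntegrableOn (fun t => N t φ) (Set.Ioc 0 y) := fun y _ => by
      have := hUi.integrableOn_fourierIntegral hL 0 φ y
      simp only [pow_zero, one_mul] at this
      exact (integrableOn_congr_fun (fun t ht => (hU t ht.1).2 φ) measurableSet_Ioc).2 this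
    have i2 : ∀ y, 0 < y → IntegrableOn
        (fun t => fourierIntegral (fun κ => L κ * U κ t) φ + Φ t φ) (Set.Ioc 0 y) := fun y hy => by
      have := hUi.integrableOn_fourierIntegral hL 1 φ y
      simp only [pow_one] at this
      exact this.add (hΦ φ y hy)
    exact ⟨i1 y hy, i2 y hy, (hN.differentiable φ).rlInt_eq hμ₁ hμ₂ hν₀ hν₁ i1 i2 (he φ)
      (hN.boundary_f φ) (hN.boundary_g φ) hy⟩
  have F₁ := facts h₁ hU₁ hUi₁ he₁
  have F₂ := facts h₂ hU₂ hUi₂ he₂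
  have sub0 : ∀ φ t, 0 < t →
      fourierIntegral (fun κ => U₁ κ t - U₂ κ t) φ = N₁ t φ - N₂ t φ := fun φ t ht => by
    rw [fourierIntegral_sub (hU₁ t ht).1 (hU₂ t ht).1, (hU₁ t ht).2, (hU₂ t ht).2]
  have hdiff : ∀ φ y, 0 < y → rlInt (1 + γ₀) (fun t => N₁ t φ - N₂ t φ) y =
      rlInt (1 + γ₀) (fun t => N₁ t φ) y - rlInt (1 + γ₀) (fun t => N₂ t φ) y := fun φ y hy =>
    rlInt_sub (rlConverges_of_integrableOn (by linarith) hy (F₁ φ y hy).1)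
      (rlConverges_of_integrableOn (by linarith) hy (F₂ φ y hy).1)
  have hzero : ∀ φ y, 0 < y →
      rlInt (1 + γ₀) (fun t => N₁ t φ) y = rlInt (1 + γ₀) (fun t => N₂ t φ) y := by
    intro φ y hy
    have := hUi.rlInt_eq_zero hL (a := 1 + γ₀) (μ := μ) (by linarith) hμ₁.le
      (fun φ y hy => ?_) φ hy
    · rw [rlInt_congr hy fun t ht _ => sub0 φ t ht, hdiff φ y hy] at this
      exact sub_eq_zero.1 this
    -- The initial data and the source cancel in the difference, and `3 - ν(2-μ) = (1+γ₀) + μ` gives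
    -- the Volterra form.
    · rw [rlInt_congr hy fun t ht _ => sub0 φ t ht, hdiff φ y hy, (F₁ φ y hy).2.2.2,
        (F₂ φ y hy).2.2.2, add_sub_add_left_eq_sub,
        ← rlInt_sub (rlConverges_of_integrableOn (by linarith) hy (F₁ φ y hy).2.1)
          (rlConverges_of_integrableOn (by linarith) hy (F₂ φ y hy).2.1),
        show 3 - ν * (2 - μ) = 1 + γ₀ + μ by rw [hγ₀]; ring]
      refine rlInt_congr hy fun t ht _ => ?_
      rw [add_sub_add_right_eq_sub, ← fourierIntegral_sub
        (locallyIntegrable_continuous_mul hL (hU₁ t ht).1)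
        (locallyIntegrable_continuous_mul hL (hU₂ t ht).1)]
      simp only [mul_sub]
  have hp : ∀ φ, Set.EqOn (rlInt γ₀ fun t => N₁ t φ) (rlInt γ₀ fun t => N₂ t φ) (Set.Ioi 0) := by
    have hcont : ∀ {N : ℝ → GenFun}, IsSolution D μ ν k f g Φ N → ∀ φ,
        ContinuousOn (rlInt γ₀ fun t => N t φ) (Set.Ioi 0) := fun hN φ t ht => by
      have := (hN.differentiable φ).2.1 0 (by norm_num) t ht
      simp only [Nat.cast_ofNat, iteratedDeriv_zero] at this
      exact this.continuousAt.continuousWithinAt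
    intro φ
    refine eqOn_of_integral_eq (fun y hy => (F₁ φ y hy).2.2.1) (fun y hy => (F₂ φ y hy).2.2.1)
      (hcont h₁ φ) (hcont h₂ φ) fun y hy => ?_
    rw [← rlInt_one, ← rlInt_one, rlInt_rlInt one_pos hγ (by linarith) hy (F₁ φ y hy).1,
      rlInt_rlInt one_pos hγ (by linarith) hy (F₂ φ y hy).1, hzero φ y hy]
  -- The Hilfer derivative sees its argument only through `I^{γ₀}` on `(0, ∞)`, which is now the
  -- same for both.
  have hH : ∀ φ, hilferDeriv 2 μ ν (fun t => N₁ t φ) y = hilferDeriv 2 μ ν (fun t => N₂ t φ) y := by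
    intro φ
    simp only [hilferDeriv, Nat.cast_ofNat]
    refine rlInt_congr hy fun t ht _ => ?_
    exact ((hp φ).eventuallyEq_of_mem (Ioi_mem_nhds ht)).iteratedDeriv_eq 2
  have hae := ae_eq_of_fourierIntegral_eq
    (locallyIntegrable_continuous_mul hL (hU₁ y hy).1)
    (locallyIntegrable_continuous_mul hL (hU₂ y hy).1) fun φ => by
      have := hH φ
      rw [he₁ φ y hy, he₂ φ y hy] at this
      exact add_right_cancel this
  ext φ
  rw [(hU₁ y hy).2, (hU₂ y hy).2]
  refine fourierIntegral_congr_ae ?_ φ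
  filter_upwards [hae, hσ0] with κ hκ h0
  exact mul_left_cancel₀ h0 hκ

/-! ### Existence -/

/-- The Fourier transform of the solution. -/
def solutionHat (μ γ₀ β : ℝ) (L fh gh : ℝ → ℂ) (κ y : ℝ) : ℂ :=
  mlKernel μ (1 - γ₀) L fh y κ + mlKernel μ (2 - γ₀) L gh y κ +
    mlKernel μ (μ - β + 1) L (fun _ => 1) y κ

theorem mul_mlKernel (μ b : ℝ) (L h : ℝ → ℂ) (y κ : ℝ) :
    L κ * mlKernel μ b L h y κ = mlKernel μ b L (fun κ => L κ * h κ) y κ := by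
  simp only [mlKernel]
  ring

theorem mul_solutionHat (μ γ₀ β : ℝ) (L fh gh : ℝ → ℂ) (κ y : ℝ) :
    L κ * solutionHat μ γ₀ β L fh gh κ y =
      mlKernel μ (1 - γ₀) L (fun κ => L κ * fh κ) y κ +
      mlKernel μ (2 - γ₀) L (fun κ => L κ * gh κ) y κ +
      mlKernel μ (μ - β + 1) L (fun κ => L κ * 1) y κ := by
  rw [solutionHat, mul_add, mul_add, mul_mlKernel, mul_mlKernel, mul_mlKernel]

section

variable {μ γ₀ β : ℝ} {L fh gh : ℝ → ℂ}

theorem fourierIntegral_add_mlKernel (hμ : 1 ≤ μ) (hL : Continuous L) {h₁ h₂ h₃ : ℝ → ℂ}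
    (hh₁ : LocallyIntegrable h₁) (hh₂ : LocallyIntegrable h₂) (hh₃ : LocallyIntegrable h₃)
    (b₁ b₂ b₃ y : ℝ) (φ : TestSpace) :
    fourierIntegral (fun κ => mlKernel μ b₁ L h₁ y κ + mlKernel μ b₂ L h₂ y κ +
      mlKernel μ b₃ L h₃ y κ) φ = fourierIntegral (mlKernel μ b₁ L h₁ y) φ +
      fourierIntegral (mlKernel μ b₂ L h₂ y) φ + fourierIntegral (mlKernel μ b₃ L h₃ y) φ := by
  have l₁ := locallyIntegrable_mlKernel hμ b₁ hL hh₁ y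
  have l₂ := locallyIntegrable_mlKernel hμ b₂ hL hh₂ y
  have l₃ := locallyIntegrable_mlKernel hμ b₃ hL hh₃ y
  rw [fourierIntegral_add (h₁ := fun κ => mlKernel μ b₁ L h₁ y κ + mlKernel μ b₂ L h₂ y κ)
    (l₁.add l₂) l₃, fourierIntegral_add l₁ l₂]

theorem locallyIntegrable_solutionHat (hμ : 1 ≤ μ) (hL : Continuous L)
    (hf : LocallyIntegrable fh) (hg : LocallyIntegrable gh) (y : ℝ) :
    LocallyIntegrable fun κ => solutionHat μ γ₀ β L fh gh κ y :=
  ((locallyIntegrable_mlKernel hμ _ hL hf y).add (locallyIntegrable_mlKernel hμ _ hL hg y)).add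
    (locallyIntegrable_mlKernel hμ _ hL (locallyIntegrable_const 1) y)

/-- Sum of the three blocks. For `b = μ-β+1` the condition `2 - γ₀ < b` is exactly `β < 1 - γ₁`. The
third block ends at `b = 1-β`; its leading term is the source, since the zeroth moment of the
constant 1 is `δ`. -/
theorem hasHilfer_solutionHat (hμ : 1 < μ) {γ₁ : ℝ} (h₀ : 0 ≤ γ₀) (h₁ : 0 ≤ γ₁)
    (h : γ₀ + γ₁ = 2 - μ) (hβ : β < 1 - γ₁) (hL : Continuous L)
    (hf : LocallyIntegrable fh) (hg : LocallyIntegrable gh) (φ : TestSpace) :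
    HasHilfer γ₀ γ₁ (fun y => fourierIntegral (fun κ => solutionHat μ γ₀ β L fh gh κ y) φ)
      (fun y => fourierIntegral (fun κ => L κ * solutionHat μ γ₀ β L fh gh κ y) φ +
        ((y ^ (-β) / Real.Gamma (1 - β) : ℝ) : ℂ) * dirac φ)
      (fourierIntegral fh φ) (fourierIntegral gh φ) := by
  have l1 : LocallyIntegrable fun _ : ℝ => (1 : ℂ) := locallyIntegrable_const 1
  have lf := locallyIntegrable_continuous_mul hL hf
  have lg := locallyIntegrable_continuous_mul hL hg
  have ll := locallyIntegrable_continuous_mul hL l1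
  have H := ((hasHilfer_powerSeries_one_sub hμ h₀ h₁ h (geomBounded_moment hL hf φ)).add
    (hasHilfer_powerSeries_two_sub hμ h₀ h₁ h (geomBounded_moment hL hg φ))).add
    (hasHilfer_powerSeries hμ h₀ h₁ h (geomBounded_moment hL l1 φ) (b := μ - β + 1) (by linarith))
  simp only [moment_zero, add_zero, zero_add] at H
  refine H.congr (fun y hy => ?_) (fun y hy => ?_)
  · simp only [solutionHat]
    rw [fourierIntegral_add_mlKernel hμ.le hL hf hg l1, fourierIntegral_mlKernel hμ.le _ hL hf hy,
      fourierIntegral_mlKernel hμ.le _ hL hg hy, fourierIntegral_mlKernel hμ.le _ hL l1 hy]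
  · simp only [mul_solutionHat]
    rw [fourierIntegral_add_mlKernel hμ.le hL lf lg ll, fourierIntegral_mlKernel hμ.le _ hL lf hy,
      fourierIntegral_mlKernel hμ.le _ hL lg hy, fourierIntegral_mlKernel hμ.le _ hL ll hy,
      ← moment_shift, ← moment_shift, ← moment_shift,
      powerSeries_eq_add_shift hμ.le (geomBounded_moment hL l1 φ) hy, moment_zero,
      ← dirac_eq_fourierIntegral, show μ - β + 1 - μ = 1 - β by ring,
      show 1 - β - 1 = -β by ring, show 1 - β + μ = μ - β + 1 by ring]
    ring

theorem isSolution_of_hasFourier {ν k : ℝ} {D : GenFun → GenFun → Prop} {f g : GenFun}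
    (hμ₁ : 1 < μ) (hμ₂ : μ ≤ 2) (hν₀ : 0 ≤ ν) (hν₁ : ν ≤ 1) (hβ : β < 1 - ν * (2 - μ))
    (hf : HasFourier f fh) (hg : HasFourier g gh) {σ : ℝ → ℂ} (hσ : Continuous σ)
    (hD : ∀ T S, D T S ↔ ∃ h, HasFourier T h ∧ HasFourier S fun κ => -σ κ * h κ)
    {N : ℝ → GenFun}
    (hN : ∀ y, 0 < y → ∀ φ, N y φ = fourierIntegral (fun κ =>
      solutionHat μ ((1 - ν) * (2 - μ)) β (fun κ => σ κ - (k : ℂ) ^ 2) fh gh κ y) φ) :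
    IsSolution D μ ν k f g
      (fun y => ((y ^ (-β) / Real.Gamma (1 - β) : ℝ) : ℂ) • dirac) N := by
  set L : ℝ → ℂ := fun κ => σ κ - (k : ℂ) ^ 2 with hLdef
  have hL : Continuous L := by fun_prop
  set γ₀ := (1 - ν) * (2 - μ) with hγ₀
  have h₀ : 0 ≤ γ₀ := mul_nonneg (by linarith) (by linarith)
  have h₁ : 0 ≤ ν * (2 - μ) := mul_nonneg hν₀ (by linarith)
  have h01 : γ₀ + ν * (2 - μ) = 2 - μ := by rw [hγ₀]; ring
  have hloc : ∀ y, LocallyIntegrable fun κ => solutionHat μ γ₀ β L fh gh κ y := fun y =>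
    locallyIntegrable_solutionHat hμ₁.le hL hf.1 hg.1 y
  have hsp : ∀ φ, _ := fun φ => HasHilfer.spec
    ((hasHilfer_solutionHat hμ₁ h₀ h₁ h01 hβ hL hf.1 hg.1 φ).congr
      (fun y hy => (hN y hy φ).symm) fun _ _ => rfl)
  have hNf : ∀ y, 0 < y → HasFourier (N y) fun κ => solutionHat μ γ₀ β L fh gh κ y :=
    fun y hy => ⟨hloc y, hN y hy⟩
  refine ⟨⟨solutionHat μ γ₀ β L fh gh, hNf, fun R Y => ?_⟩, fun φ => (hsp φ).1,
    fun y hy => ?_, fun φ => ?_, fun φ => ?_, fun y hy φ => ?_⟩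
  · exact ((integrableOn_mlKernel hμ₁.le (by linarith) hL hf.1 R Y).add
      (integrableOn_mlKernel hμ₁.le (by linarith) hL hg.1 R Y)).add
      (integrableOn_mlKernel hμ₁.le (by linarith) hL (locallyIntegrable_const 1) R Y)
  · have hl : LocallyIntegrable fun κ => -σ κ * solutionHat μ γ₀ β L fh gh κ y :=
      locallyIntegrable_continuous_mul (c := fun κ => -σ κ) (by fun_prop) (hloc y)
    refine ⟨genFunOf _ hl, (hD _ _).2 ⟨_, hNf y hy, hl, fun φ => rfl⟩, fun φ => ?_⟩
    have e2 : fourierIntegral (fun κ => L κ * solutionHat μ γ₀ β L fh gh κ y) φ +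
        fourierIntegral (fun κ => -σ κ * solutionHat μ γ₀ β L fh gh κ y) φ =
        -(k : ℂ) ^ 2 * fourierIntegral (fun κ => solutionHat μ γ₀ β L fh gh κ y) φ := by
      rw [← fourierIntegral_add (locallyIntegrable_continuous_mul hL (hloc y)) hl,
        ← fourierIntegral_const_mul]
      congr 1
      funext κ
      rw [hLdef]
      ring
    rw [(hsp φ).2.1 y hy, hN y hy φ]
    change fourierIntegral (fun κ => -σ κ * solutionHat μ γ₀ β L fh gh κ y) φ + _ + _ =
      ((y ^ (-β) / Real.Gamma (1 - β) : ℝ) : ℂ) * dirac φ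
    linear_combination e2
  · rw [hf.2]
    exact (hsp φ).2.2.1
  · rw [hg.2]
    exact (hsp φ).2.2.2
  · simp only [hN y hy]
    exact tendsto_fourierIntegral_translate _ φ

end

/-! ### The symbol of the Riesz–Feller derivative -/

theorem norm_psi (α θ κ : ℝ) : ‖psi α θ κ‖ = |κ| ^ α := by
  rw [psi, norm_mul, mul_comm Complex.I, Complex.norm_exp_ofReal_mul_I, mul_one, Complex.norm_real,
    Real.norm_of_nonneg (by positivity)]

/-- The phase jumps at 0, but `|κ|^α` vanishes there. -/
theorem continuous_psi {α : ℝ} (hα : 0 < α) (θ : ℝ) : Continuous (psi α θ) := by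
  have h1 : Continuous fun κ : ℝ => ((|κ| ^ α : ℝ) : ℂ) :=
    Complex.continuous_ofReal.comp
      ((Real.continuous_rpow_const hα.le).comp continuous_abs)
  have h2 : psi α θ = fun κ => if κ ≤ 0
      then ((|κ| ^ α : ℝ) : ℂ) * Complex.exp (Complex.I * (-1 * (θ * Real.pi / 2) : ℝ))
      else ((|κ| ^ α : ℝ) : ℂ) * Complex.exp (Complex.I * (1 * (θ * Real.pi / 2) : ℝ)) := by
    funext κ
    rcases lt_trichotomy κ 0 with h | h | h
    · rw [if_pos h.le, psi, Real.sign_of_neg h]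
    · subst h
      simp [psi, Real.zero_rpow hα.ne']
    · rw [if_neg h.not_ge, psi, Real.sign_of_pos h]
  rw [h2]
  refine Continuous.if_le (h1.mul continuous_const) (h1.mul continuous_const) continuous_id
    continuous_const fun κ hκ => ?_
  simp [hκ, Real.zero_rpow hα.ne']

/-- Taking moduli, a zero satisfies `|κ|^α = k²`, which leaves at most two points. -/
theorem ae_mul_psi_sub_ne_zero {α : ℝ} (hα : 0 < α) (θ k : ℝ) {s : ℝ} (hs : |s| = 1) :
    ∀ᵐ κ : ℝ, (s : ℂ) * psi α θ κ - (k : ℂ) ^ 2 ≠ 0 := by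
  set r := (k ^ 2) ^ α⁻¹
  have hfin : ({r, -r} : Set ℝ).Finite := by simp
  refine (hfin.measure_zero volume : _) |> measure_mono_null fun κ hκ => ?_
  simp only [Set.mem_compl_iff, Set.mem_ofPred_eq, not_not] at hκ
  have h1 : |κ| ^ α = k ^ 2 := by
    have := congrArg norm (sub_eq_zero.1 hκ)
    rw [norm_mul, norm_psi, Complex.norm_real, Real.norm_eq_abs, hs, one_mul, norm_pow,
      Complex.norm_real, Real.norm_eq_abs, sq_abs] at this
    exact this
  have h2 : |κ| = r := by
    rw [← Real.rpow_rpow_inv (abs_nonneg κ) hα.ne', h1]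
  rcases abs_choice κ with h | h
  · left
    rw [← h2, h]
  · right
    rw [Set.mem_singleton_iff, ← h2, h, neg_neg]

theorem fourierIntegral_solutionHat {μ : ℝ} (hμ : 1 ≤ μ) (γ₀ β : ℝ) {L fh gh : ℝ → ℂ}
    (hL : Continuous L) (hf : LocallyIntegrable fh) (hg : LocallyIntegrable gh) (y : ℝ)
    (φ : TestSpace) :
    fourierIntegral (fun κ => solutionHat μ γ₀ β L fh gh κ y) φ =
      ((y ^ (-γ₀) : ℝ) : ℂ) *
        fourierIntegral (fun κ => mittagLeffler μ (1 - γ₀) (((y ^ μ : ℝ) : ℂ) * L κ) * fh κ) φ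
      + ((y ^ (1 - γ₀) : ℝ) : ℂ) *
        fourierIntegral (fun κ => mittagLeffler μ (2 - γ₀) (((y ^ μ : ℝ) : ℂ) * L κ) * gh κ) φ
      + ((y ^ (μ - β) : ℝ) : ℂ) *
        fourierIntegral (fun κ => mittagLeffler μ (μ - β + 1) (((y ^ μ : ℝ) : ℂ) * L κ)) φ := by
  simp only [solutionHat]
  rw [fourierIntegral_add_mlKernel hμ hL hf hg (locallyIntegrable_const 1)]
  have h : ∀ b h, fourierIntegral (mlKernel μ b L h y) φ = ((y ^ (b - 1) : ℝ) : ℂ) *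
      fourierIntegral (fun κ => mittagLeffler μ b (((y ^ μ : ℝ) : ℂ) * L κ) * h κ) φ :=
    fun b h => fourierIntegral_const_mul _ _ φ
  simp only [h, mul_one]
  rw [show 1 - γ₀ - 1 = -γ₀ by ring, show 2 - γ₀ - 1 = 1 - γ₀ by ring,
    show μ - β + 1 - 1 = μ - β by ring]

theorem integrableOn_source {β : ℝ} (hβ : β < 1) (c : ℂ) {y : ℝ} (hy : 0 < y) :
    IntegrableOn (fun t : ℝ => ((t ^ (-β) / Real.Gamma (1 - β) : ℝ) : ℂ) * c) (Set.Ioc 0 y) :=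
  (Integrable.ofReal (((intervalIntegrable_iff_integrableOn_Ioc_of_le hy.le).1
    (intervalIntegral.intervalIntegrable_rpow' (by linarith))).div_const _)).mul_const c

end

end FracHelmholtz

/-! ### Assembly: existence, uniqueness and the explicit formula -/

theorem corollary5
    (α θ μ ν β k : ℝ) (hα₁ : 1 < α) (hα₂ : α ≤ 2) (hθ : |θ| ≤ min α (2 - α))
    (hμ₁ : 1 < μ) (hμ₂ : μ ≤ 2) (hν₀ : 0 ≤ ν) (hν₁ : ν ≤ 1)
    (hβ : β < 1 - ν * (2 - μ))
    -- boundary data, with locally integrable Fourier transforms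
    (f g : FracHelmholtz.GenFun) (fh gh : ℝ → ℂ)
    (hf : FracHelmholtz.HasFourier f fh) (hg : FracHelmholtz.HasFourier g gh)
    -- upper sign: Riesz–Feller derivative; lower sign: quantum Riesz–Feller derivative
    (D : FracHelmholtz.GenFun → FracHelmholtz.GenFun → Prop) (s : ℝ)
    (hD : (D = FracHelmholtz.IsRieszFeller α θ ∧ s = 1) ∨
      (D = FracHelmholtz.IsQuantumRieszFeller α θ ∧ s = -1))
    -- the source `δ(x) y^{-β} / Γ(1-β)`
    (Φ : ℝ → FracHelmholtz.GenFun)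
    (hΦ : Φ = fun y => ((y ^ (-β) / Real.Gamma (1 - β) : ℝ) : ℂ) • FracHelmholtz.dirac)
    -- the three integrands of the solution formula
    (F G H : ℝ → ℝ → ℂ)
    (hF : F = fun y κ => FracHelmholtz.mittagLeffler μ (1 - (1 - ν) * (2 - μ))
      (((y ^ μ : ℝ) : ℂ) * (s * FracHelmholtz.psi α θ κ - (k : ℂ) ^ 2)) * fh κ)
    (hG : G = fun y κ => FracHelmholtz.mittagLeffler μ (2 - (1 - ν) * (2 - μ))
      (((y ^ μ : ℝ) : ℂ) * (s * FracHelmholtz.psi α θ κ - (k : ℂ) ^ 2)) * gh κ)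
    (hH : H = fun y κ => FracHelmholtz.mittagLeffler μ (μ - β + 1)
      (((y ^ μ : ℝ) : ℂ) * (s * FracHelmholtz.psi α θ κ - (k : ℂ) ^ 2))) :
    -- the integrands are locally integrable, so their Fourier integrals make sense
    (∀ y, 0 < y → LocallyIntegrable (F y) ∧ LocallyIntegrable (G y) ∧
      LocallyIntegrable (H y)) ∧
    -- a solution exists
    (∃ N, FracHelmholtz.IsSolution D μ ν k f g Φ N) ∧
    -- and the solutions are exactly what the formula gives
    ∀ N : ℝ → FracHelmholtz.GenFun,
      (FracHelmholtz.IsSolution D μ ν k f g Φ N ↔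
        ∀ y, 0 < y → ∀ φ : FracHelmholtz.TestSpace,
          N y φ =
            ((y ^ (-((1 - ν) * (2 - μ))) : ℝ) : ℂ) * FracHelmholtz.fourierIntegral (F y) φ
            + ((y ^ (1 - (1 - ν) * (2 - μ)) : ℝ) : ℂ) * FracHelmholtz.fourierIntegral (G y) φ
            + ((y ^ (μ - β) : ℝ) : ℂ) * FracHelmholtz.fourierIntegral (H y) φ) ∧
      -- where the integrals converge absolutely, the solution is an ordinary function of `x`
      (FracHelmholtz.IsSolution D μ ν k f g Φ N →
        ∀ y, 0 < y → Integrable (F y) → Integrable (G y) → Integrable (H y) →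
          ∃ n : ℝ → ℂ,
            (∀ x : ℝ, n x =
              ((y ^ (-((1 - ν) * (2 - μ))) / (2 * Real.pi) : ℝ) : ℂ) *
                  (∫ κ : ℝ, F y κ * Complex.exp (-(Complex.I * κ * x)))
              + ((y ^ (1 - (1 - ν) * (2 - μ)) / (2 * Real.pi) : ℝ) : ℂ) *
                  (∫ κ : ℝ, G y κ * Complex.exp (-(Complex.I * κ * x)))
              + ((y ^ (μ - β) / (2 * Real.pi) : ℝ) : ℂ) *
                  (∫ κ : ℝ, H y κ * Complex.exp (-(Complex.I * κ * x)))) ∧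
            (∀ φ : FracHelmholtz.TestSpace,
              Integrable (fun x : ℝ => n x * (φ : SchwartzMap ℝ ℂ) x) ∧
              N y φ = ∫ x : ℝ, n x * (φ : SchwartzMap ℝ ℂ) x) ∧
            Tendsto n (cocompact ℝ) (𝓝 0)) := by
  have hβ1 : β < 1 := by nlinarith
  -- Both derivatives are treated at once as multiplication by `-σ` with `σ = sψ`; the rest of the
  -- argument uses only the continuity of `σ` and `|s| = 1`.
  obtain ⟨hs, hD⟩ : |s| = 1 ∧ ∀ T S, D T S ↔ ∃ h, FracHelmholtz.HasFourier T h ∧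
      FracHelmholtz.HasFourier S fun κ => -((s : ℂ) * FracHelmholtz.psi α θ κ) * h κ := by
    rcases hD with ⟨rfl, rfl⟩ | ⟨rfl, rfl⟩
    · refine ⟨by simp, fun T S => ?_⟩
      simp only [Complex.ofReal_one, one_mul]
      rfl
    · refine ⟨by simp, fun T S => ?_⟩
      simp only [Complex.ofReal_neg, Complex.ofReal_one, neg_mul, one_mul, neg_neg]
      rfl
  have hσ : Continuous fun κ => (s : ℂ) * FracHelmholtz.psi α θ κ :=
    continuous_const.mul (FracHelmholtz.continuous_psi (by linarith) θ)
  have hL : Continuous fun κ => (s : ℂ) * FracHelmholtz.psi α θ κ - (k : ℂ) ^ 2 :=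
    hσ.sub continuous_const
  have hform : ∀ y φ, FracHelmholtz.fourierIntegral (fun κ => FracHelmholtz.solutionHat μ
      ((1 - ν) * (2 - μ)) β (fun κ => (s : ℂ) * FracHelmholtz.psi α θ κ - (k : ℂ) ^ 2)
      fh gh κ y) φ = ((y ^ (-((1 - ν) * (2 - μ))) : ℝ) : ℂ) * FracHelmholtz.fourierIntegral (F y) φ
        + ((y ^ (1 - (1 - ν) * (2 - μ)) : ℝ) : ℂ) * FracHelmholtz.fourierIntegral (G y) φ
        + ((y ^ (μ - β) : ℝ) : ℂ) * FracHelmholtz.fourierIntegral (H y) φ := fun y φ => by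
    rw [hF, hG, hH]
    exact FracHelmholtz.fourierIntegral_solutionHat hμ₁.le _ _ hL hf.1 hg.1 y φ
  have hsol : ∀ {N : ℝ → FracHelmholtz.GenFun}, (∀ y, 0 < y → ∀ φ, N y φ =
      FracHelmholtz.fourierIntegral (fun κ => FracHelmholtz.solutionHat μ
      ((1 - ν) * (2 - μ)) β (fun κ => (s : ℂ) * FracHelmholtz.psi α θ κ - (k : ℂ) ^ 2)
      fh gh κ y) φ) → FracHelmholtz.IsSolution D μ ν k f g Φ N := fun hN => by
    rw [hΦ]
    exact FracHelmholtz.isSolution_of_hasFourier hμ₁ hμ₂ hν₀ hν₁ hβ hf hg hσ hD hN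
  have hex : FracHelmholtz.IsSolution D μ ν k f g Φ fun y => FracHelmholtz.genFunOf _
      (FracHelmholtz.locallyIntegrable_solutionHat (γ₀ := (1 - ν) * (2 - μ)) (β := β)
        hμ₁.le hL hf.1 hg.1 y) := hsol fun _ _ _ => rfl
  have hsrc : ∀ φ y, 0 < y → IntegrableOn (fun t => Φ t φ) (Set.Ioc 0 y) := fun φ y hy => by
    rw [hΦ]
    exact FracHelmholtz.integrableOn_source hβ1 _ hy
  have hiff : ∀ N : ℝ → FracHelmholtz.GenFun, FracHelmholtz.IsSolution D μ ν k f g Φ N ↔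
      ∀ y, 0 < y → ∀ φ : FracHelmholtz.TestSpace, N y φ =
        ((y ^ (-((1 - ν) * (2 - μ))) : ℝ) : ℂ) * FracHelmholtz.fourierIntegral (F y) φ
        + ((y ^ (1 - (1 - ν) * (2 - μ)) : ℝ) : ℂ) * FracHelmholtz.fourierIntegral (G y) φ
        + ((y ^ (μ - β) : ℝ) : ℂ) * FracHelmholtz.fourierIntegral (H y) φ := fun N => by
    refine ⟨fun hN y hy φ => ?_, fun hN => hsol fun y hy φ => by rw [hN y hy φ, hform]⟩
    -- Any solution equals the constructed one, for which the formula holds by definition.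
    rw [FracHelmholtz.IsSolution.unique hμ₁ hμ₂ hν₀ hν₁ hsrc hσ
      (FracHelmholtz.ae_mul_psi_sub_ne_zero (by linarith) θ k hs) hD hN hex hy]
    exact hform y φ
  refine ⟨fun y _ => ⟨?_, ?_, ?_⟩, ⟨_, hex⟩, fun N => ⟨hiff N, fun hN y hy iF iG iH => ?_⟩⟩
  · rw [hF]
    exact FracHelmholtz.locallyIntegrable_mittagLeffler_mul hμ₁.le _ hL hf.1 y
  · rw [hG]
    exact FracHelmholtz.locallyIntegrable_mittagLeffler_mul hμ₁.le _ hL hg.1 y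
  · rw [hH]
    simpa only [mul_one] using FracHelmholtz.locallyIntegrable_mittagLeffler_mul hμ₁.le (μ - β + 1)
      hL (locallyIntegrable_const (1 : ℂ)) y
  · refine ⟨_, fun x => rfl, fun φ => ?_, ?_⟩
    · obtain ⟨jF, eF⟩ := FracHelmholtz.fourierIntegral_of_integrable iF φ
      obtain ⟨jG, eG⟩ := FracHelmholtz.fourierIntegral_of_integrable iG φ
      obtain ⟨jH, eH⟩ := FracHelmholtz.fourierIntegral_of_integrable iH φ
      have kF := jF.const_mul ((y ^ (-((1 - ν) * (2 - μ))) : ℝ) : ℂ)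
      have kG := jG.const_mul ((y ^ (1 - (1 - ν) * (2 - μ)) : ℝ) : ℂ)
      have kH := jH.const_mul ((y ^ (μ - β) : ℝ) : ℂ)
      have hsplit := fun x : ℝ => show _ = _ from
        (by push_cast; ring :
        (((y ^ (-((1 - ν) * (2 - μ))) / (2 * Real.pi) : ℝ) : ℂ) *
            (∫ κ : ℝ, F y κ * Complex.exp (-(Complex.I * κ * x)))
          + ((y ^ (1 - (1 - ν) * (2 - μ)) / (2 * Real.pi) : ℝ) : ℂ) *
            (∫ κ : ℝ, G y κ * Complex.exp (-(Complex.I * κ * x)))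
          + ((y ^ (μ - β) / (2 * Real.pi) : ℝ) : ℂ) *
            (∫ κ : ℝ, H y κ * Complex.exp (-(Complex.I * κ * x)))) * (φ : SchwartzMap ℝ ℂ) x =
        ((y ^ (-((1 - ν) * (2 - μ))) : ℝ) : ℂ) * (((2 * Real.pi : ℂ)⁻¹ *
            ∫ κ : ℝ, F y κ * Complex.exp (-(Complex.I * κ * x))) * (φ : SchwartzMap ℝ ℂ) x)
          + ((y ^ (1 - (1 - ν) * (2 - μ)) : ℝ) : ℂ) * (((2 * Real.pi : ℂ)⁻¹ *
            ∫ κ : ℝ, G y κ * Complex.exp (-(Complex.I * κ * x))) * (φ : SchwartzMap ℝ ℂ) x)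
          + ((y ^ (μ - β) : ℝ) : ℂ) * (((2 * Real.pi : ℂ)⁻¹ *
            ∫ κ : ℝ, H y κ * Complex.exp (-(Complex.I * κ * x))) * (φ : SchwartzMap ℝ ℂ) x))
      simp only [hsplit]
      refine ⟨(kF.add kG).add kH, ?_⟩
      have hadd := integral_add (kF.add kG) kH
      simp only [Pi.add_apply] at hadd
      rw [(hiff N).1 hN y hy φ, eF, eG, eH, hadd, integral_add kF kG,
        integral_const_mul, integral_const_mul, integral_const_mul]
    · have := (((FracHelmholtz.tendsto_integral_mul_exp (F y)).const_mul
        ((y ^ (-((1 - ν) * (2 - μ))) / (2 * Real.pi) : ℝ) : ℂ)).add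
        ((FracHelmholtz.tendsto_integral_mul_exp (G y)).const_mul
        ((y ^ (1 - (1 - ν) * (2 - μ)) / (2 * Real.pi) : ℝ) : ℂ))).add
        ((FracHelmholtz.tendsto_integral_mul_exp (H y)).const_mul
        ((y ^ (μ - β) / (2 * Real.pi) : ℝ) : ℂ))
      simpa only [mul_zero, add_zero] using this
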